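/- For each $n\ge1$ let $\mathbf y=X\beta^0+\epsilon\in\mathbb R^n$, where $\epsilon\sim N(0,\sigma_0^2I_n)$ with $\sigma_0>0$, $X$ is an $n\times n$ design matrix (so $p=n$), either deterministic or random and independent of $\epsilon$, with $X^TX=nI_n$ almost surely, and $\beta^0=\beta^{0,n}\in\mathbb R^n$ is the deterministic true coefficient vector. All random variables live on one probability space. A model is a subset $\gamma\subseteq\{1,\dots,n\}$; the true model is $\gamma^0=\{j:\beta^0_j\ne0\}$. Given $\nu>0$ (fixed) and $\phi_n>0$, consider the Bayesian model $$\mathbf y\mid\beta,\sigma^2\sim N(X\beta,\sigma^2I_n),\qquad \beta_j\mid\gamma,\sigma^2\ \overset{\text{indep.}}{\sim}\ \begin{cases}N(0,\phi_n\sigma^2)& j\in\gamma\\ \delta_0& j\notin\gamma\end{cases},\qquad 1/\sigma^2\sim\chi^2_\nu,\qquad p(\gamma)=2^{-n}\ \text{for all }\gamma,$$ and let $p(\gamma\mid Z)$, $Z=(\mathbf y,X)$, denote the resulting posterior probability of $\gamma$. Posterior model consistency (PMC) means $p(\gamma^0\mid Z)\to1$ in probability. Assume that for some constants $\delta_1>1$,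 $c_1>0$ and a fixed integer $s>0$, for all large $n$: $|\gamma^0|=s$ and $\min_{j\in\gamma^0}|\beta^0_j|\ge\psi_n$, where $\psi_n\ge0$ and $\psi_n^2=c_1n^{1+\delta_1}(\log n)^2$; and assume $\|\beta^0\|_2^2=O(\psi_n^2)$. Then, as $n\to\infty$: (a) Suppose $\phi_n=c_2n^{\delta_2}$ for constants $c_2>0$ and $\delta_2\in\mathbb R$. (i) If $-1<\delta_2\le1$, then $\max_{\gamma\ne\gamma^0}p(\gamma\mid Z)/p(\gamma^0\mid Z)\to0$ in probability, but PMC does not hold. Specifically, if $-1<\delta_2<1$, then $p(\gamma^0\mid Z)\to0$ almost surely; if $\delta_2=1$, then there is a constant $0<c_0<1$ such that $\limsup_np(\gamma^0\mid Z)\le c_0$ almost surely. (ii) If $1<\delta_2\le\delta_1$, then $p(\gamma^0\mid Z)\to1$ in probability. (b) If $n^{n\log n}=O(\phi_n)$, then $p(\emptyset\mid Z)/p(\gamma^0\mid Z)\to\infty$ in probability, where $\emptyset$ is the null model, and $p(\gamma^0\mid Z)\to0$ in probability. (c) If $n\phi_n\to\eta\in[0,\infty)$, then almost surely $\liminf_n\max_{\gamma\ne\gamma^0}p(\gamma\mid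 Z)/p(\gamma^0\mid Z)\ge(1+\eta)^{-1/2}$ and $\lim_np(\gamma^0\mid Z)=0$. -/

import Mathlib

open MeasureTheory ProbabilityTheory Filter Topology Asymptotics
open scoped Matrix

noncomputable section

namespace BVS

/-- The state vector of `β`, encoded as the set of indices `j` with `β j ≠ 0`.
A model is a set of indices in `Fin p`. -/
def stateVector {p : ℕ} (β : Fin p → ℝ) : Finset (Fin p) :=
  Finset.univ.filter fun j => β j ≠ 0

/-- The chi-squared distribution with `ν` degrees of freedom, i.e. the gamma distribution with
shape `ν / 2` and rate `1 / 2`. -/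
def chiSquared (ν : ℝ) : Measure ℝ := gammaMeasure (ν / 2) (1 / 2)

/-- The prior of the coefficient vector given the model `γ` and the error variance `v = σ²`: the
coordinates are independent, the `j`-th one is `N(0, c j * σ²)` if `j ∈ γ`, and it is a point mass
at zero otherwise. -/
def coefPrior {p : ℕ} (c : Fin p → ℝ) (γ : Finset (Fin p)) (v : ℝ) : Measure (Fin p → ℝ) :=
  Measure.pi fun j => if j ∈ γ then gaussianReal 0 (c j * v).toNNReal else Measure.dirac 0

/-- The density at `y` of `N(X β, σ² I_n)`, where `v = σ²`. -/
def likelihood {n p : ℕ} (X : Matrix (Fin n) (Fin p) ℝ) (β : Fin p → ℝ) (v : ℝ)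
    (y : Fin n → ℝ) : ℝ :=
  ∏ i, gaussianPDFReal ((X *ᵥ β) i) v.toNNReal (y i)

/-- The marginal density of `y` given the model `γ` (and the design `X`): the coefficients and the
error variance are integrated out; the variable `t` is `1 / σ²`, which is chi-squared. -/
def marginalLikelihood {n p : ℕ} (ν : ℝ) (c : Fin p → ℝ) (X : Matrix (Fin n) (Fin p) ℝ)
    (y : Fin n → ℝ) (γ : Finset (Fin p)) : ℝ :=
  ∫ t, ∫ β, likelihood X β t⁻¹ y ∂(coefPrior c γ t⁻¹) ∂(chiSquared ν)

/-- The posterior probability `p(γ | Z)`, `Z = (y, X)`, of the model `γ` when the models have prior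
probabilities `prior`. -/
def posteriorProb {n p : ℕ} (ν : ℝ) (c : Fin p → ℝ) (prior : Finset (Fin p) → ℝ)
    (X : Matrix (Fin n) (Fin p) ℝ) (y : Fin n → ℝ) (γ : Finset (Fin p)) : ℝ :=
  prior γ * marginalLikelihood ν c X y γ / ∑ γ', prior γ' * marginalLikelihood ν c X y γ'

/-- The posterior odds ratio `p(γ | Z) / p(γ₀ | Z)` in favor of `γ`. -/
def posteriorOdds {n p : ℕ} (ν : ℝ) (c : Fin p → ℝ) (prior : Finset (Fin p) → ℝ)
    (X : Matrix (Fin n) (Fin p) ℝ) (y : Fin n → ℝ) (γ₀ γ : Finset (Fin p)) : ℝ :=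
  posteriorProb ν c prior X y γ / posteriorProb ν c prior X y γ₀

/-- `max_{γ ≠ γ₀} p(γ | Z) / p(γ₀ | Z)`; the supremum is over a finite set, which is nonempty
whenever `p ≥ 1`. -/
def maxPosteriorOdds {n p : ℕ} (ν : ℝ) (c : Fin p → ℝ) (prior : Finset (Fin p) → ℝ)
    (X : Matrix (Fin n) (Fin p) ℝ) (y : Fin n → ℝ) (γ₀ : Finset (Fin p)) : ℝ :=
  ⨆ γ : {γ : Finset (Fin p) // γ ≠ γ₀}, posteriorOdds ν c prior X y γ₀ γ

/-- The flat prior `p(γ) = 2^{-p}` on the `2^p` models. -/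
def flatPrior (p : ℕ) : Finset (Fin p) → ℝ := fun _ => (2 ^ p)⁻¹

/-- Divergence to `+∞` in probability. -/
def TendstoInProbAtTop {Ω : Type*} [MeasurableSpace Ω] (P : Measure Ω) (f : ℕ → Ω → ℝ) : Prop :=
  ∀ M : ℝ, Tendsto (fun n => P {ω | f n ω ≤ M}) atTop (𝓝 0)

end BVS

end

/-! Under an orthogonal design the coordinates decouple. With `φ = φ_n`, the posterior weight of a
model `γ` is, up to a common factor, `(1 + nφ)^(-|γ|/2) D(γ)^(-(n+ν)/2)`, where `D(γ)` is one plus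
the sum of the squared scores (the entries of `n^(-1/2) Xᵀy`), those in `γ` being divided by
`1 + nφ`. Enlarging a model costs at most the factor `(1 + nφ)^(-1/2)` per index whatever the data
are, and the true model has about `n` one-element enlargements, which together have at least
`n (1 + nφ)^(-1/2)` times its weight. This ratio changes from large to small where `φ` passes `n`,
and gives the statements that hold almost surely.

For the convergence in probability it suffices that every noise score is at most `log n`. Omitting a
true index then multiplies the weight by a factor which decays faster than the number `2^n` of
models grows, while superfluous indices cost `(1 + nφ)^(-1/2)` up to a constant, so that the weights
of the models containing the true one sum up like a binomial series. If `φ` is as large as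
`n^(n log n)`, this cost exceeds anything that the fit can gain, and the null model wins. -/

noncomputable section

namespace BVS

section OrthogonalDesign

/-- A design matrix with `n` rows whose columns are orthogonal of squared length `n`. -/
def IsOrthogonalDesign {n p : ℕ} (X : Matrix (Fin n) (Fin p) ℝ) : Prop :=
  Xᵀ * X = (n : ℝ) • (1 : Matrix (Fin p) (Fin p) ℝ)

/-- The normalized score vector `n^{-1/2} Xᵀ y`. Under an orthogonal design it holds the coordinates
of `y` along the orthonormal columns of `n^{-1/2} X`. -/
def score {n p : ℕ} (X : Matrix (Fin n) (Fin p) ℝ) (y : Fin n → ℝ) : Fin p → ℝ :=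
  (√n)⁻¹ • (Xᵀ *ᵥ y)

variable {n p : ℕ}

theorem score_add (X : Matrix (Fin n) (Fin p) ℝ) (u v : Fin n → ℝ) :
    score X (u + v) = score X u + score X v := by
  rw [score, Matrix.mulVec_add, smul_add, score, score]

theorem score_sub (X : Matrix (Fin n) (Fin p) ℝ) (u v : Fin n → ℝ) :
    score X (u - v) = score X u - score X v := by
  rw [score, Matrix.mulVec_sub, smul_sub, score, score]

theorem score_apply (X : Matrix (Fin n) (Fin p) ℝ) (u : Fin n → ℝ) (j : Fin p) :
    score X u j = ∑ i, (√n)⁻¹ * X i j * u i := by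
  simp only [score, Pi.smul_apply, Matrix.mulVec, dotProduct, Matrix.transpose_apply, smul_eq_mul,
    Finset.mul_sum, mul_assoc]

theorem measurable_score (j : Fin p) :
    Measurable fun z : (Fin n → Fin p → ℝ) × (Fin n → ℝ) => score (Matrix.of z.1) z.2 j := by
  simp only [score_apply, Matrix.of_apply]
  fun_prop

namespace IsOrthogonalDesign

theorem score_mulVec {X : Matrix (Fin n) (Fin p) ℝ} (hX : IsOrthogonalDesign X) (β : Fin p → ℝ) :
    score X (X *ᵥ β) = √n • β := by
  rw [score, Matrix.mulVec_mulVec, hX, Matrix.smul_mulVec, Matrix.one_mulVec, smul_smul,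
    ← div_eq_inv_mul, Real.div_sqrt]

theorem score_mulVec_add {X : Matrix (Fin n) (Fin p) ℝ} (hX : IsOrthogonalDesign X)
    (β : Fin p → ℝ) (ε : Fin n → ℝ) (j : Fin p) :
    score X (X *ᵥ β + ε) j = √n * β j + score X ε j := by
  rw [score_add, hX.score_mulVec, Pi.add_apply, Pi.smul_apply, smul_eq_mul]

theorem sum_col_sq {X : Matrix (Fin n) (Fin p) ℝ} (hX : IsOrthogonalDesign X) (j : Fin p) :
    ∑ i, X i j ^ 2 = n := by
  have h := congrFun₂ hX j j
  simpa [Matrix.mul_apply, sq] using h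

theorem mul_transpose {X : Matrix (Fin n) (Fin n) ℝ} (hX : IsOrthogonalDesign X) :
    X * Xᵀ = (n : ℝ) • (1 : Matrix (Fin n) (Fin n) ℝ) := by
  rcases eq_or_ne n 0 with rfl | hn
  · exact Subsingleton.elim _ _
  have hn : (n : ℝ) ≠ 0 := Nat.cast_ne_zero.2 hn
  have hleft : (n : ℝ)⁻¹ • Xᵀ * X = 1 := by
    rw [Matrix.smul_mul, hX, inv_smul_smul₀ hn]
  rw [← inv_smul_eq_iff₀ hn, ← Matrix.mul_smul]
  exact mul_eq_one_comm.1 hleft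

theorem sum_score_sq {X : Matrix (Fin n) (Fin n) ℝ} (hX : IsOrthogonalDesign X)
    (u : Fin n → ℝ) : ∑ j, score X u j ^ 2 = ∑ i, u i ^ 2 := by
  suffices score X u ⬝ᵥ score X u = u ⬝ᵥ u by simpa only [dotProduct, ← sq] using this
  rcases eq_or_ne n 0 with rfl | hn
  · simp
  have hn : (n : ℝ) ≠ 0 := Nat.cast_ne_zero.2 hn
  rw [score, smul_dotProduct, dotProduct_smul, Matrix.dotProduct_mulVec, Matrix.vecMul_transpose,
    Matrix.mulVec_mulVec, hX.mul_transpose, Matrix.smul_mulVec, Matrix.one_mulVec,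
    smul_dotProduct, smul_smul, smul_smul, ← mul_inv, Real.mul_self_sqrt n.cast_nonneg,
    inv_mul_cancel₀ hn, one_smul]

end IsOrthogonalDesign

end OrthogonalDesign

section OddsBound

variable {ι : Type*} [DecidableEq ι]

/-- The odds `f` of the models against `γ₀` decay geometrically, at rate `θ`, in the number of
superfluous indices of a model containing `γ₀`, and are at most `τ` for all other models. -/
structure OddsBound (f : Finset ι → ℝ) (γ₀ : Finset ι) (θ τ : ℝ) : Prop where
  le_pow : ∀ γ, γ₀ ⊆ γ → f γ ≤ θ ^ (γ \ γ₀).card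
  le_of_not_subset : ∀ γ, ¬ γ₀ ⊆ γ → f γ ≤ τ

namespace OddsBound

variable {f : Finset ι → ℝ} {γ₀ γ : Finset ι} {θ τ : ℝ}

theorem mono {θ' τ' : ℝ} (h : OddsBound f γ₀ θ τ) (hθ : 0 ≤ θ) (hθ' : θ ≤ θ') (hτ' : τ ≤ τ') :
    OddsBound f γ₀ θ' τ' where
  le_pow γ hγ := (h.le_pow γ hγ).trans (by gcongr)
  le_of_not_subset γ hγ := (h.le_of_not_subset γ hγ).trans hτ'

theorem le_add_of_ne (h : OddsBound f γ₀ θ τ) (hθ : 0 ≤ θ) (hθ1 : θ ≤ 1) (hτ : 0 ≤ τ)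
    (hγ : γ ≠ γ₀) : f γ ≤ θ + τ := by
  by_cases hsub : γ₀ ⊆ γ
  · have hcard : (γ \ γ₀).card ≠ 0 := by
      rw [Finset.card_ne_zero, Finset.sdiff_nonempty]
      exact fun h' => hγ (h'.antisymm hsub)
    linarith [h.le_pow γ hsub, pow_le_of_le_one hθ hθ1 hcard]
  · linarith [h.le_of_not_subset γ hsub]

theorem sum_le [Fintype ι] (h : OddsBound f γ₀ θ τ) (hθ : 0 ≤ θ) (hτ : 0 ≤ τ) :
    ∑ γ, f γ ≤ (1 + θ) ^ Fintype.card ι + 2 ^ Fintype.card ι * τ := by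
  have hle : ∀ γ, f γ ≤ (if γ₀ ⊆ γ then θ ^ (γ \ γ₀).card else 0) + τ := by
    intro γ
    split_ifs with hγ
    · exact (h.le_pow γ hγ).trans (le_add_of_nonneg_right hτ)
    · exact (h.le_of_not_subset γ hγ).trans_eq (zero_add τ).symm
  have hinj : Set.InjOn (· \ γ₀) (Finset.univ.filter (γ₀ ⊆ ·) : Finset (Finset ι)) := by
    intro γ hγ γ' hγ' heq
    have hγ : γ₀ ⊆ γ := by simpa using hγ
    have hγ' : γ₀ ⊆ γ' := by simpa using hγ'
    rw [← Finset.sdiff_union_of_subset hγ, ← Finset.sdiff_union_of_subset hγ']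
    exact congrArg (· ∪ γ₀) heq
  calc ∑ γ, f γ ≤ ∑ γ with γ₀ ⊆ γ, θ ^ (γ \ γ₀).card + ∑ _γ : Finset ι, τ := by
        rw [Finset.sum_filter, ← Finset.sum_add_distrib]
        exact Finset.sum_le_sum fun γ _ => hle γ
    _ ≤ ∑ T : Finset ι, θ ^ T.card + ∑ _γ : Finset ι, τ := by
        rw [← Finset.sum_image (f := fun T : Finset ι => θ ^ T.card) hinj]
        gcongr
        exact Finset.subset_univ _
    _ = _ := by
        have hbinomial := Fintype.sum_pow_mul_eq_add_pow ι θ 1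
        simp only [one_pow, mul_one] at hbinomial
        rw [hbinomial, add_comm θ, Finset.sum_const, Finset.card_univ, Fintype.card_finset,
          nsmul_eq_mul, Nat.cast_pow, Nat.cast_ofNat]

end OddsBound

end OddsBound

section Weights

variable {ι : Type*} [Fintype ι] [DecidableEq ι]

/-- One plus the sum of the squares of `w`, where those with index in `γ` are shrunk by `1 + a`. For
the score vector of the data this is the scale parameter of the posterior of `1 / σ²` under the
model `γ`. -/
def dispersion (a : ℝ) (w : ι → ℝ) (γ : Finset ι) : ℝ :=
  1 + ∑ j, w j ^ 2 / if j ∈ γ then 1 + a else 1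

/-- The closed form of the marginal likelihood of `γ` under an orthogonal design, up to a factor not
depending on `γ`: here `a = n φ`, `q = (n + ν) / 2` and `w` is the score vector of the data. -/
def modelWeight (q a : ℝ) (w : ι → ℝ) (γ : Finset ι) : ℝ :=
  (√(1 + a))⁻¹ ^ γ.card * dispersion a w γ ^ (-q)

variable {a q : ℝ} {γ₀ γ : Finset ι}

theorem one_le_dispersion (ha : 0 ≤ a) (w : ι → ℝ) (γ : Finset ι) : 1 ≤ dispersion a w γ :=
  le_add_of_nonneg_right <| Finset.sum_nonneg fun j _ => by split_ifs <;> positivity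

theorem modelWeight_pos (ha : 0 ≤ a) (q : ℝ) (w : ι → ℝ) (γ : Finset ι) :
    0 < modelWeight q a w γ := by
  have := one_le_dispersion ha w γ
  unfold modelWeight
  positivity

theorem dispersion_anti (ha : 0 ≤ a) (w : ι → ℝ) (h : γ₀ ⊆ γ) :
    dispersion a w γ ≤ dispersion a w γ₀ := by
  unfold dispersion
  gcongr with j
  split_ifs with hγ₀ hγ hγ
  exacts [le_rfl, absurd (h hγ₀) hγ, le_add_of_nonneg_right ha, le_rfl]

theorem sq_le_dispersion_of_notMem (ha : 0 ≤ a) (w : ι → ℝ) {j : ι} (hj : j ∉ γ) :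
    w j ^ 2 ≤ dispersion a w γ := by
  have h := Finset.single_le_sum (f := fun j => w j ^ 2 / if j ∈ γ then 1 + a else 1)
    (fun i _ => by split_ifs <;> positivity) (Finset.mem_univ j)
  simp only [hj, if_false, div_one] at h
  exact h.trans (le_add_of_nonneg_left zero_le_one)

theorem sq_div_le_dispersion (ha : 0 ≤ a) (w : ι → ℝ) (γ : Finset ι) (j : ι) :
    w j ^ 2 / (1 + a) ≤ dispersion a w γ := by
  calc w j ^ 2 / (1 + a) ≤ w j ^ 2 / if j ∈ γ then 1 + a else 1 := by
        gcongr
        split_ifs <;> linarith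
    _ ≤ ∑ j, w j ^ 2 / if j ∈ γ then 1 + a else 1 :=
        Finset.single_le_sum (f := fun j => w j ^ 2 / if j ∈ γ then 1 + a else 1)
          (fun i _ => by split_ifs <;> positivity) (Finset.mem_univ j)
    _ ≤ dispersion a w γ := le_add_of_nonneg_left zero_le_one

theorem dispersion_empty (a : ℝ) (w : ι → ℝ) : dispersion a w ∅ = 1 + ∑ j, w j ^ 2 := by
  simp [dispersion]

theorem dispersion_le {w : ι → ℝ} {b : ℝ} (hb : 0 ≤ b)
    (hnull : ∀ j ∉ γ, w j ^ 2 ≤ b) :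
    dispersion a w γ ≤ 1 + Fintype.card ι * b + (∑ j ∈ γ, w j ^ 2) / (1 + a) := by
  calc dispersion a w γ ≤ 1 + ∑ j, (b + if j ∈ γ then w j ^ 2 / (1 + a) else 0) := by
        unfold dispersion
        gcongr with j
        split_ifs with hj
        · exact le_add_of_nonneg_left hb
        · simpa using hnull j hj
    _ = _ := by simp [Finset.sum_add_distrib, Finset.sum_div, add_assoc]

theorem dispersion_le_add_card (ha : 0 ≤ a) {w : ι → ℝ} {b : ℝ} (hnull : ∀ j ∉ γ₀, w j ^ 2 ≤ b)
    (h : γ₀ ⊆ γ) : dispersion a w γ₀ ≤ dispersion a w γ + (γ \ γ₀).card * b := by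
  have hsum : ((γ \ γ₀).card : ℝ) * b = ∑ j, if j ∈ γ \ γ₀ then b else 0 := by
    rw [Finset.sum_ite_mem, Finset.univ_inter, Finset.sum_const, nsmul_eq_mul]
  rw [hsum, dispersion, dispersion, add_assoc, ← Finset.sum_add_distrib]
  gcongr with j
  by_cases hγ₀ : j ∈ γ₀
  · simp [hγ₀, h hγ₀]
  by_cases hγ : j ∈ γ
  · have : 0 ≤ w j ^ 2 / (1 + a) := by positivity
    simpa [hγ₀, hγ] using (hnull j hγ₀).trans (le_add_of_nonneg_left this)
  · simp [hγ₀, hγ]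

theorem dispersion_le_mul_exp (ha : 0 ≤ a) {w : ι → ℝ} {A b : ℝ} (hA : 0 < A) (hb : 0 ≤ b)
    {i : ι} (hi : A ≤ w i ^ 2) (hnull : ∀ j ∉ γ₀, w j ^ 2 ≤ b) (h : γ₀ ⊆ γ) :
    dispersion a w γ₀ ≤ dispersion a w γ * Real.exp ((γ \ γ₀).card * (b * (1 + a) / A)) := by
  have hAD : A / (1 + a) ≤ dispersion a w γ :=
    (by gcongr : A / (1 + a) ≤ w i ^ 2 / (1 + a)).trans (sq_div_le_dispersion ha w γ i)
  have hbD : b ≤ dispersion a w γ * (b * (1 + a) / A) :=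
    calc b = A / (1 + a) * (b * (1 + a) / A) := by field_simp
      _ ≤ _ := by gcongr
  have hD := one_le_dispersion ha w γ
  calc dispersion a w γ₀ ≤ dispersion a w γ + (γ \ γ₀).card * b :=
        dispersion_le_add_card ha hnull h
    _ ≤ dispersion a w γ + (γ \ γ₀).card * (dispersion a w γ * (b * (1 + a) / A)) := by gcongr
    _ = dispersion a w γ * ((γ \ γ₀).card * (b * (1 + a) / A) + 1) := by ring
    _ ≤ _ := by gcongr; exact Real.add_one_le_exp _

theorem inv_sqrt_mul_modelWeight_le (ha : 0 ≤ a) (hq : 0 ≤ q) (w : ι → ℝ) {j : ι} (hj : j ∉ γ) :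
    (√(1 + a))⁻¹ * modelWeight q a w γ ≤ modelWeight q a w (insert j γ) := by
  have hpos := one_pos.trans_le (one_le_dispersion ha w (insert j γ))
  have hanti := dispersion_anti ha w (Finset.subset_insert j γ)
  rw [modelWeight, modelWeight, Finset.card_insert_of_notMem hj, pow_succ', ← mul_assoc]
  gcongr ?_ * ?_
  exact Real.rpow_le_rpow_of_nonpos hpos hanti (neg_nonpos.2 hq)

theorem modelWeight_mul_le_sum (ha : 0 ≤ a) (hq : 0 ≤ q) (w : ι → ℝ) (γ : Finset ι) :
    (1 + γᶜ.card / √(1 + a)) * modelWeight q a w γ ≤ ∑ γ', modelWeight q a w γ' := by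
  have hinj : Set.InjOn (fun j => insert j γ) (γᶜ : Finset ι) := by
    simpa using Finset.insert_inj_on γ
  have hnot : γ ∉ γᶜ.image fun j => insert j γ := by simp
  calc (1 + γᶜ.card / √(1 + a)) * modelWeight q a w γ
      = modelWeight q a w γ + ∑ _j ∈ γᶜ, (√(1 + a))⁻¹ * modelWeight q a w γ := by
        rw [Finset.sum_const, nsmul_eq_mul]
        ring
    _ ≤ modelWeight q a w γ + ∑ j ∈ γᶜ, modelWeight q a w (insert j γ) := by
        gcongr with j hj
        exact inv_sqrt_mul_modelWeight_le ha hq w (Finset.mem_compl.1 hj)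
    _ = ∑ γ' ∈ insert γ (γᶜ.image fun j => insert j γ), modelWeight q a w γ' := by
        rw [Finset.sum_insert hnot, Finset.sum_image hinj]
    _ ≤ _ := Finset.sum_le_sum_of_subset_of_nonneg (Finset.subset_univ _)
        fun γ' _ _ => (modelWeight_pos ha q w γ').le

theorem modelWeight_le_of_subset (ha : 0 ≤ a) (hq : 0 ≤ q) {w : ι → ℝ} {A b : ℝ} (hA : 0 < A)
    (hb : 0 ≤ b) {i : ι} (hi : A ≤ w i ^ 2) (hnull : ∀ j ∉ γ₀, w j ^ 2 ≤ b) (h : γ₀ ⊆ γ) :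
    modelWeight q a w γ ≤
      ((√(1 + a))⁻¹ * Real.exp (q * (b * (1 + a) / A))) ^ (γ \ γ₀).card *
        modelWeight q a w γ₀ := by
  set k := (γ \ γ₀).card
  set κ := b * (1 + a) / A
  have hD := one_le_dispersion ha w γ
  have hD₀ := one_le_dispersion ha w γ₀
  have hpow : dispersion a w γ ^ (-q) ≤ Real.exp (q * κ) ^ k * dispersion a w γ₀ ^ (-q) := by
    have hdisp := dispersion_le_mul_exp ha hA hb hi hnull h
    have hexp : Real.exp (q * κ) ^ k = Real.exp (k * κ) ^ q := by
      rw [← Real.exp_nat_mul, ← Real.exp_mul]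
      ring_nf
    rw [hexp, Real.rpow_neg (by positivity), Real.rpow_neg (by positivity), ← div_eq_mul_inv,
      inv_le_comm₀ (by positivity) (by positivity), inv_div, div_le_iff₀ (by positivity),
      ← Real.mul_rpow (by positivity) (by positivity)]
    exact Real.rpow_le_rpow (by positivity) hdisp hq
  have hcard : γ.card = k + γ₀.card := (Finset.card_sdiff_add_card_eq_card h).symm
  rw [modelWeight, modelWeight, hcard, pow_add, mul_pow, mul_mul_mul_comm]
  calc _ ≤ (√(1 + a))⁻¹ ^ k * (√(1 + a))⁻¹ ^ γ₀.card *
        (Real.exp (q * κ) ^ k * dispersion a w γ₀ ^ (-q)) := by gcongr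
    _ = _ := by ring

theorem modelWeight_le_of_not_subset (ha : 0 ≤ a) (hq : 0 ≤ q) {w : ι → ℝ} {A ρ : ℝ} (hρ : 0 < ρ)
    (hsignal : ∀ j ∈ γ₀, A ≤ w j ^ 2) (hdisp : dispersion a w γ₀ ≤ ρ * A) (h : ¬ γ₀ ⊆ γ) :
    modelWeight q a w γ ≤ √(1 + a) ^ γ₀.card * ρ ^ q * modelWeight q a w γ₀ := by
  obtain ⟨j, hj, hjγ⟩ := Finset.not_subset.1 h
  have hD := one_le_dispersion ha w γ
  have hD₀ := one_le_dispersion ha w γ₀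
  have hsqrt : 1 ≤ √(1 + a) := Real.one_le_sqrt.2 (le_add_of_nonneg_right ha)
  have hratio : dispersion a w γ₀ / ρ ≤ dispersion a w γ := by
    rw [div_le_iff₀' hρ]
    refine hdisp.trans ?_
    gcongr
    exact (hsignal j hj).trans (sq_le_dispersion_of_notMem ha w hjγ)
  have hpow : dispersion a w γ ^ (-q) ≤ ρ ^ q * dispersion a w γ₀ ^ (-q) := by
    have := Real.rpow_le_rpow_of_nonpos (by positivity) hratio (neg_nonpos.2 hq)
    rwa [Real.div_rpow (by positivity) hρ.le, Real.rpow_neg hρ.le, div_inv_eq_mul,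
      mul_comm] at this
  calc modelWeight q a w γ ≤ 1 * (ρ ^ q * dispersion a w γ₀ ^ (-q)) := by
        unfold modelWeight
        gcongr
        exact pow_le_one₀ (by positivity) (inv_le_one_of_one_le₀ hsqrt)
    _ = (√(1 + a) * (√(1 + a))⁻¹) ^ γ₀.card * (ρ ^ q * dispersion a w γ₀ ^ (-q)) := by
        rw [mul_inv_cancel₀ (by positivity), one_pow]
    _ = _ := by
        rw [modelWeight, mul_pow]
        ring

theorem oddsBound_modelWeight (ha : 0 ≤ a) (hq : 0 ≤ q) {w : ι → ℝ} {A b ρ : ℝ} (hA : 0 < A)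
    (hb : 0 ≤ b) (hne : γ₀.Nonempty) (hsignal : ∀ j ∈ γ₀, A ≤ w j ^ 2)
    (hnull : ∀ j ∉ γ₀, w j ^ 2 ≤ b) (hdisp : dispersion a w γ₀ ≤ ρ * A) :
    OddsBound (fun γ => modelWeight q a w γ / modelWeight q a w γ₀) γ₀
      ((√(1 + a))⁻¹ * Real.exp (q * (b * (1 + a) / A))) (√(1 + a) ^ γ₀.card * ρ ^ q) where
  le_pow γ h := by
    obtain ⟨i, hi⟩ := hne
    rw [div_le_iff₀ (modelWeight_pos ha q w γ₀)]
    exact modelWeight_le_of_subset ha hq hA hb (hsignal i hi) hnull h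
  le_of_not_subset γ h := by
    have hρ : 0 < ρ := pos_of_mul_pos_left
      (one_pos.trans_le ((one_le_dispersion ha w γ₀).trans hdisp)) hA.le
    rw [div_le_iff₀ (modelWeight_pos ha q w γ₀)]
    exact modelWeight_le_of_not_subset ha hq hρ hsignal hdisp h

end Weights

section MarginalLikelihood

theorem prod_gaussianPDFReal {ι : Type*} [Fintype ι] (m : ι → ℝ) (v : NNReal) (x : ι → ℝ) :
    ∏ i, gaussianPDFReal (m i) v (x i) =
      (√(2 * Real.pi * v))⁻¹ ^ Fintype.card ι *
        Real.exp (-(∑ i, (x i - m i) ^ 2) / (2 * v)) := by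
  simp only [gaussianPDFReal, Finset.prod_mul_distrib, Finset.prod_const, Finset.card_univ,
    ← Real.exp_sum, neg_div, Finset.sum_div, Finset.sum_neg_distrib]

theorem IsOrthogonalDesign.likelihood_eq_prod {n : ℕ} {X : Matrix (Fin n) (Fin n) ℝ}
    (hX : IsOrthogonalDesign X) (β : Fin n → ℝ) (v : ℝ) (y : Fin n → ℝ) :
    likelihood X β v y = ∏ j, gaussianPDFReal (√n * β j) v.toNNReal (score X y j) := by
  have hnorm := hX.sum_score_sq (y - X *ᵥ β)
  simp only [score_sub, hX.score_mulVec, Pi.sub_apply, Pi.smul_apply, smul_eq_mul] at hnorm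
  rw [likelihood, prod_gaussianPDFReal, prod_gaussianPDFReal, hnorm]

-- Completing the square: both sides are the joint density of `(b, w)`.
theorem gaussianPDFReal_mul_gaussianPDFReal {r φ v : ℝ} (hφ : 0 < φ) (hv : 0 < v) (w b : ℝ) :
    gaussianPDFReal 0 (φ * v).toNNReal b * gaussianPDFReal (r * b) v.toNNReal w =
      gaussianPDFReal 0 ((1 + r ^ 2 * φ) * v).toNNReal w *
        gaussianPDFReal (r * φ * w / (1 + r ^ 2 * φ)) (φ * v / (1 + r ^ 2 * φ)).toNNReal b := by
  have : 0 < 1 + r ^ 2 * φ := by positivity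
  simp only [gaussianPDFReal]
  rw [Real.coe_toNNReal _ (by positivity), Real.coe_toNNReal _ hv.le,
    Real.coe_toNNReal _ (by positivity), Real.coe_toNNReal _ (by positivity), mul_mul_mul_comm,
    mul_mul_mul_comm (√(2 * Real.pi * ((1 + r ^ 2 * φ) * v)))⁻¹, ← Real.exp_add, ← Real.exp_add,
    ← mul_inv, ← mul_inv, ← Real.sqrt_mul (by positivity), ← Real.sqrt_mul (by positivity)]
  congr 1
  · congr 2
    field_simp
  · congr 1
    field_simp
    ring

theorem integral_gaussianPDFReal_gaussianReal {r φ v : ℝ} (hφ : 0 < φ) (hv : 0 < v) (w : ℝ) :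
    ∫ b, gaussianPDFReal (r * b) v.toNNReal w ∂(gaussianReal 0 (φ * v).toNNReal) =
      gaussianPDFReal 0 ((1 + r ^ 2 * φ) * v).toNNReal w := by
  have hprior : (φ * v).toNNReal ≠ 0 := (Real.toNNReal_pos.2 (by positivity)).ne'
  have hposterior : (φ * v / (1 + r ^ 2 * φ)).toNNReal ≠ 0 :=
    (Real.toNNReal_pos.2 (by positivity)).ne'
  simp only [integral_gaussianReal_eq_integral_smul hprior, smul_eq_mul,
    gaussianPDFReal_mul_gaussianPDFReal hφ hv]
  rw [integral_const_mul, integral_gaussianPDFReal_eq_one _ hposterior, mul_one]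

theorem gaussianPDFReal_mul_inv {c t : ℝ} (hc : 0 < c) (ht : 0 < t) (w : ℝ) :
    gaussianPDFReal 0 (c * t⁻¹).toNNReal w =
      (√(2 * Real.pi))⁻¹ * √t * ((√c)⁻¹ * Real.exp (-(t / 2) * (w ^ 2 / c))) := by
  have hexponent : -(w - 0) ^ 2 / (2 * (c * t⁻¹)) = -(t / 2) * (w ^ 2 / c) := by
    field_simp
    ring
  rw [gaussianPDFReal, Real.coe_toNNReal _ (by positivity), hexponent,
    Real.sqrt_mul (by positivity), Real.sqrt_mul hc.le, Real.sqrt_inv, mul_inv, mul_inv, inv_inv]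
  ring

theorem integral_gaussianPDFReal_coordPrior {r φ t : ℝ} (hφ : 0 < φ) (ht : 0 < t) (w : ℝ)
    (active : Prop) [Decidable active] :
    ∫ b, gaussianPDFReal (r * b) t⁻¹.toNNReal w
        ∂(if active then gaussianReal 0 (φ * t⁻¹).toNNReal else Measure.dirac 0) =
      (√(2 * Real.pi))⁻¹ * √t * ((if active then (√(1 + r ^ 2 * φ))⁻¹ else 1) *
        Real.exp (-(t / 2) * (w ^ 2 / if active then 1 + r ^ 2 * φ else 1))) := by
  split_ifs
  · rw [integral_gaussianPDFReal_gaussianReal hφ (inv_pos.2 ht),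
      gaussianPDFReal_mul_inv (by positivity) ht]
  · rw [integral_dirac, mul_zero, ← one_mul t⁻¹, gaussianPDFReal_mul_inv one_pos ht, Real.sqrt_one,
      inv_one]

theorem IsOrthogonalDesign.integral_likelihood_coefPrior {n : ℕ} {X : Matrix (Fin n) (Fin n) ℝ}
    (hX : IsOrthogonalDesign X) {φ t : ℝ} (hφ : 0 < φ) (ht : 0 < t) (y : Fin n → ℝ)
    (γ : Finset (Fin n)) :
    ∫ β, likelihood X β t⁻¹ y ∂(coefPrior (fun _ => φ) γ t⁻¹) =
      ((√(2 * Real.pi))⁻¹ * √t) ^ n * ((√(1 + n * φ))⁻¹ ^ γ.card *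
        Real.exp (-(t / 2) * (dispersion (n * φ) (score X y) γ - 1))) := by
  have (j : Fin n) : SigmaFinite (if j ∈ γ then gaussianReal 0 (φ * t⁻¹).toNNReal
      else Measure.dirac (0 : ℝ)) := by split_ifs <;> infer_instance
  simp only [hX.likelihood_eq_prod, coefPrior]
  rw [integral_fintype_prod_eq_prod
    (f := fun j b => gaussianPDFReal (√n * b) t⁻¹.toNNReal (score X y j))]
  simp only [integral_gaussianPDFReal_coordPrior hφ ht, Real.sq_sqrt n.cast_nonneg,
    Finset.prod_mul_distrib, Finset.prod_const, Finset.card_univ, Fintype.card_fin,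
    Finset.prod_ite, ← Real.exp_sum, ← Finset.mul_sum, one_pow, mul_one, dispersion,
    add_sub_cancel_left, mul_pow, Finset.filter_univ_mem]

theorem integral_gammaMeasure {a r : ℝ} (ha : 0 < a) (hr : 0 < r) (f : ℝ → ℝ) :
    ∫ t, f t ∂(gammaMeasure a r) =
      ∫ t in Set.Ioi 0, r ^ a / Real.Gamma a * t ^ (a - 1) * Real.exp (-(r * t)) * f t := by
  have hm : Measurable (gammaPDF a r) := (measurable_gammaPDFReal a r).ennreal_ofReal
  have hne : ∀ᵐ t : ℝ, t ≠ 0 := Measure.ae_ne volume 0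
  rw [gammaMeasure, integral_withDensity_eq_integral_toReal_smul hm (by simp [gammaPDF]),
    ← integral_indicator measurableSet_Ioi]
  refine integral_congr_ae (hne.mono fun t ht => ?_)
  simp only [gammaPDF, ENNReal.toReal_ofReal (gammaPDFReal_nonneg ha hr t)]
  rcases ht.lt_or_gt with h | h
  · simp [gammaPDFReal, h.not_ge, h.not_gt]
  · simp [gammaPDFReal, h, h.le]

theorem integral_rpow_mul_exp_gammaMeasure {a r k c : ℝ} (ha : 0 < a) (hr : 0 < r)
    (hk : 0 < a + k) (hc : 0 < r + c) :
    ∫ t, t ^ k * Real.exp (-(c * t)) ∂(gammaMeasure a r) =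
      r ^ a * Real.Gamma (a + k) / Real.Gamma a * (r + c) ^ (-(a + k)) := by
  have hcombine : Set.EqOn
      (fun t => r ^ a / Real.Gamma a * t ^ (a - 1) * Real.exp (-(r * t)) *
        (t ^ k * Real.exp (-(c * t))))
      (fun t => r ^ a / Real.Gamma a * (t ^ (a + k - 1) * Real.exp (-((r + c) * t))))
      (Set.Ioi 0) := fun t ht => by
    have hpow : t ^ (a + k - 1) = t ^ (a - 1) * t ^ k := by
      rw [← Real.rpow_add ht, sub_add_eq_add_sub]
    simp only [hpow, add_mul, neg_add, Real.exp_add]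
    ring
  rw [integral_gammaMeasure ha hr, setIntegral_congr_fun measurableSet_Ioi hcombine,
    integral_const_mul, Real.integral_rpow_mul_exp_neg_mul_Ioi hk hc, Real.rpow_neg hc.le,
    one_div, Real.inv_rpow hc.le]
  ring

theorem integral_gammaMeasure_congr {a r : ℝ} (ha : 0 < a) (hr : 0 < r) {f g : ℝ → ℝ}
    (h : Set.EqOn f g (Set.Ioi 0)) :
    ∫ t, f t ∂(gammaMeasure a r) = ∫ t, g t ∂(gammaMeasure a r) := by
  rw [integral_gammaMeasure ha hr, integral_gammaMeasure ha hr]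
  exact setIntegral_congr_fun measurableSet_Ioi fun t ht => congrArg _ (h ht)

theorem IsOrthogonalDesign.exists_marginalLikelihood_eq {n : ℕ} {X : Matrix (Fin n) (Fin n) ℝ}
    (hX : IsOrthogonalDesign X) {ν φ : ℝ} (hν : 0 < ν) (hφ : 0 < φ) (y : Fin n → ℝ) :
    ∃ C > 0, ∀ γ, marginalLikelihood ν (fun _ => φ) X y γ =
      C * modelWeight ((n + ν) / 2) (n * φ) (score X y) γ := by
  have := Real.Gamma_pos_of_pos (s := ν / 2) (by positivity)
  have := Real.Gamma_pos_of_pos (s := ν / 2 + n / 2) (by positivity)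
  refine ⟨(√(2 * Real.pi))⁻¹ ^ n * ((1 / 2) ^ (ν / 2) * Real.Gamma (ν / 2 + n / 2) /
    Real.Gamma (ν / 2) * (1 / 2) ^ (-((n + ν) / 2))), by positivity, fun γ => ?_⟩
  set D := dispersion (n * φ) (score X y) γ with hD
  have hD_pos : 0 < D := one_pos.trans_le (one_le_dispersion (by positivity) _ _)
  have hinner : Set.EqOn (fun t => ∫ β, likelihood X β t⁻¹ y ∂(coefPrior (fun _ => φ) γ t⁻¹))
      (fun t => (√(2 * Real.pi))⁻¹ ^ n * (√(1 + n * φ))⁻¹ ^ γ.card *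
        (t ^ ((n : ℝ) / 2) * Real.exp (-((D - 1) / 2 * t)))) (Set.Ioi 0) := fun t ht => by
    have hexponent : -(t / 2) * (D - 1) = -((D - 1) / 2 * t) := by ring
    have hpow : √t ^ n = t ^ ((n : ℝ) / 2) := by
      rw [Real.sqrt_eq_rpow, ← Real.rpow_mul_natCast (le_of_lt ht), one_div_mul_eq_div]
    simp only [hX.integral_likelihood_coefPrior hφ ht, ← hD, mul_pow, hpow, hexponent]
    ring
  rw [marginalLikelihood, chiSquared, integral_gammaMeasure_congr (by positivity) one_half_pos
    hinner, integral_const_mul, integral_rpow_mul_exp_gammaMeasure (by positivity) one_half_pos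
    (by positivity) (by linarith), modelWeight, ← hD,
    show (1 / 2 : ℝ) + (D - 1) / 2 = 1 / 2 * D by ring,
    show ν / 2 + (n : ℝ) / 2 = (n + ν) / 2 by ring, Real.mul_rpow one_half_pos.le hD_pos.le]
  ring

end MarginalLikelihood

section Posterior

variable {n : ℕ} {X : Matrix (Fin n) (Fin n) ℝ} {ν φ θ τ : ℝ} {y : Fin n → ℝ}
  {γ₀ : Finset (Fin n)}

theorem posteriorProb_eq (hX : IsOrthogonalDesign X) (hν : 0 < ν) (hφ : 0 < φ) (y : Fin n → ℝ)
    (γ : Finset (Fin n)) :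
    posteriorProb ν (fun _ => φ) (flatPrior n) X y γ =
      modelWeight ((n + ν) / 2) (n * φ) (score X y) γ /
        ∑ γ', modelWeight ((n + ν) / 2) (n * φ) (score X y) γ' := by
  obtain ⟨C, hC, hmarginal⟩ := hX.exists_marginalLikelihood_eq hν hφ y
  simp only [posteriorProb, flatPrior, hmarginal, ← Finset.mul_sum, ← mul_assoc]
  exact mul_div_mul_left _ _ (by positivity)

theorem sum_modelWeight_pos (hφ : 0 < φ) (q : ℝ) (w : Fin n → ℝ) :
    0 < ∑ γ, modelWeight q (n * φ) w γ :=
  Finset.sum_pos (fun γ _ => modelWeight_pos (by positivity) q w γ) Finset.univ_nonempty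

theorem posteriorOdds_eq (hX : IsOrthogonalDesign X) (hν : 0 < ν) (hφ : 0 < φ) (y : Fin n → ℝ)
    (γ₀ γ : Finset (Fin n)) :
    posteriorOdds ν (fun _ => φ) (flatPrior n) X y γ₀ γ =
      modelWeight ((n + ν) / 2) (n * φ) (score X y) γ /
        modelWeight ((n + ν) / 2) (n * φ) (score X y) γ₀ := by
  rw [posteriorOdds, posteriorProb_eq hX hν hφ, posteriorProb_eq hX hν hφ,
    div_div_div_cancel_right₀ (sum_modelWeight_pos hφ _ _).ne']

theorem posteriorProb_pos (hX : IsOrthogonalDesign X) (hν : 0 < ν) (hφ : 0 < φ) (y : Fin n → ℝ)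
    (γ : Finset (Fin n)) : 0 < posteriorProb ν (fun _ => φ) (flatPrior n) X y γ := by
  rw [posteriorProb_eq hX hν hφ]
  exact div_pos (modelWeight_pos (by positivity) _ _ _) (sum_modelWeight_pos hφ _ _)

theorem sum_posteriorProb (hX : IsOrthogonalDesign X) (hν : 0 < ν) (hφ : 0 < φ) (y : Fin n → ℝ) :
    ∑ γ, posteriorProb ν (fun _ => φ) (flatPrior n) X y γ = 1 := by
  simp only [posteriorProb_eq hX hν hφ, ← Finset.sum_div]
  exact div_self (sum_modelWeight_pos hφ _ _).ne'

theorem posteriorProb_le_one (hX : IsOrthogonalDesign X) (hν : 0 < ν) (hφ : 0 < φ)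
    (y : Fin n → ℝ) (γ : Finset (Fin n)) :
    posteriorProb ν (fun _ => φ) (flatPrior n) X y γ ≤ 1 :=
  sum_posteriorProb hX hν hφ y ▸ Finset.single_le_sum
    (fun γ' _ => (posteriorProb_pos hX hν hφ y γ').le) (Finset.mem_univ γ)

theorem posteriorOdds_nonneg (hX : IsOrthogonalDesign X) (hν : 0 < ν) (hφ : 0 < φ)
    (y : Fin n → ℝ) (γ₀ γ : Finset (Fin n)) :
    0 ≤ posteriorOdds ν (fun _ => φ) (flatPrior n) X y γ₀ γ :=
  div_nonneg (posteriorProb_pos hX hν hφ y γ).le (posteriorProb_pos hX hν hφ y γ₀).le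

theorem posteriorProb_le_inv_posteriorOdds (hX : IsOrthogonalDesign X) (hν : 0 < ν) (hφ : 0 < φ)
    (y : Fin n → ℝ) (γ₀ γ : Finset (Fin n)) :
    posteriorProb ν (fun _ => φ) (flatPrior n) X y γ₀ ≤
      (posteriorOdds ν (fun _ => φ) (flatPrior n) X y γ₀ γ)⁻¹ := by
  rw [posteriorOdds, inv_div]
  exact le_div_self (posteriorProb_pos hX hν hφ y γ₀).le (posteriorProb_pos hX hν hφ y γ)
    (posteriorProb_le_one hX hν hφ y γ)

theorem posteriorProb_eq_inv_sum_posteriorOdds (hX : IsOrthogonalDesign X) (hν : 0 < ν)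
    (hφ : 0 < φ) (y : Fin n → ℝ) (γ₀ : Finset (Fin n)) :
    posteriorProb ν (fun _ => φ) (flatPrior n) X y γ₀ =
      (∑ γ, posteriorOdds ν (fun _ => φ) (flatPrior n) X y γ₀ γ)⁻¹ := by
  simp only [posteriorOdds, ← Finset.sum_div, sum_posteriorProb hX hν hφ, one_div, inv_inv]

theorem posteriorProb_le (hX : IsOrthogonalDesign X) (hν : 0 < ν) (hφ : 0 < φ) (y : Fin n → ℝ)
    (γ : Finset (Fin n)) :
    posteriorProb ν (fun _ => φ) (flatPrior n) X y γ ≤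
      √(1 + n * φ) / (√(1 + n * φ) + γᶜ.card) := by
  have : 0 < √(1 + n * φ) := by positivity
  have hsum := modelWeight_mul_le_sum (q := (n + ν) / 2) (by positivity : 0 ≤ n * φ) (by positivity)
    (score X y) γ
  have hbound : √(1 + n * φ) / (√(1 + n * φ) + γᶜ.card) = (1 + γᶜ.card / √(1 + n * φ))⁻¹ := by
    field_simp
  rw [posteriorProb_eq hX hν hφ, hbound, div_le_iff₀ (sum_modelWeight_pos hφ _ _),
    ← div_eq_inv_mul, le_div_iff₀' (by positivity)]
  exact hsum

theorem inv_sqrt_le_maxPosteriorOdds (hX : IsOrthogonalDesign X) (hν : 0 < ν) (hφ : 0 < φ)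
    (y : Fin n → ℝ) (hcard : γ₀.card < n) :
    (√(1 + n * φ))⁻¹ ≤ maxPosteriorOdds ν (fun _ => φ) (flatPrior n) X y γ₀ := by
  have ha : 0 ≤ n * φ := by positivity
  obtain ⟨j, -, hj⟩ := Finset.exists_mem_notMem_of_card_lt_card
    (hcard.trans_eq (Finset.card_fin n).symm)
  have hne : insert j γ₀ ≠ γ₀ := fun h => hj (h ▸ Finset.mem_insert_self j γ₀)
  calc (√(1 + n * φ))⁻¹
      ≤ posteriorOdds ν (fun _ => φ) (flatPrior n) X y γ₀ (insert j γ₀) := by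
        rw [posteriorOdds_eq hX hν hφ, le_div_iff₀ (modelWeight_pos ha _ _ _)]
        exact inv_sqrt_mul_modelWeight_le ha (by positivity) _ hj
    _ ≤ _ := le_ciSup (f := fun γ : {γ : Finset (Fin n) // γ ≠ γ₀} =>
        posteriorOdds ν (fun _ => φ) (flatPrior n) X y γ₀ γ) (Set.finite_range _).bddAbove
        ⟨insert j γ₀, hne⟩

theorem OddsBound.abs_maxPosteriorOdds_le
    (h : OddsBound (posteriorOdds ν (fun _ => φ) (flatPrior n) X y γ₀) γ₀ θ τ)
    (hX : IsOrthogonalDesign X) (hν : 0 < ν) (hφ : 0 < φ) (hθ : 0 ≤ θ) (hθ1 : θ ≤ 1)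
    (hτ : 0 ≤ τ) :
    |maxPosteriorOdds ν (fun _ => φ) (flatPrior n) X y γ₀| ≤ θ + τ := by
  rw [maxPosteriorOdds, abs_of_nonneg (Real.iSup_nonneg fun γ : {γ // γ ≠ γ₀} =>
    posteriorOdds_nonneg hX hν hφ y γ₀ γ)]
  exact Real.iSup_le (fun γ => h.le_add_of_ne hθ hθ1 hτ γ.2) (by positivity)

theorem OddsBound.abs_posteriorProb_sub_one_le
    (h : OddsBound (posteriorOdds ν (fun _ => φ) (flatPrior n) X y γ₀) γ₀ θ τ)
    (hX : IsOrthogonalDesign X) (hν : 0 < ν) (hφ : 0 < φ) (hθ : 0 ≤ θ) (hτ : 0 ≤ τ) :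
    |posteriorProb ν (fun _ => φ) (flatPrior n) X y γ₀ - 1| ≤
      Real.exp (n * θ) - 1 + 2 ^ n * τ := by
  have hsum : ∑ γ, posteriorOdds ν (fun _ => φ) (flatPrior n) X y γ₀ γ ≤
      Real.exp (n * θ) + 2 ^ n * τ :=
    calc _ ≤ (1 + θ) ^ n + 2 ^ n * τ := by simpa only [Fintype.card_fin] using h.sum_le hθ hτ
      _ ≤ Real.exp θ ^ n + 2 ^ n * τ := by
        gcongr
        exact (add_comm 1 θ).trans_le (Real.add_one_le_exp θ)
      _ = _ := by rw [Real.exp_nat_mul]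
  have hpos := posteriorProb_pos hX hν hφ y γ₀
  have hle := posteriorProb_le_one hX hν hφ y γ₀
  rw [← inv_inv (∑ γ, _), ← posteriorProb_eq_inv_sum_posteriorOdds hX hν hφ] at hsum
  rw [abs_sub_comm, abs_of_nonneg (sub_nonneg.2 hle)]
  calc 1 - posteriorProb ν (fun _ => φ) (flatPrior n) X y γ₀
      ≤ (posteriorProb ν (fun _ => φ) (flatPrior n) X y γ₀)⁻¹ - 1 := by
        simpa only [inv_inv] using (Real.one_sub_inv_le_log_of_pos (inv_pos.2 hpos)).trans
          (Real.log_le_sub_one_of_pos (inv_pos.2 hpos))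
    _ ≤ _ := by linarith

end Posterior

section Signal

/-- The posterior odds of `γ` against the true model `stateVector β` for the response `X β + ε`,
under the prior with common scale `φ` and the flat prior on the models. -/
def oddsAgainstTrue {n : ℕ} (ν φ : ℝ) (X : Matrix (Fin n) (Fin n) ℝ) (β ε : Fin n → ℝ)
    (γ : Finset (Fin n)) : ℝ :=
  posteriorOdds ν (fun _ => φ) (flatPrior n) X (X *ᵥ β + ε) (stateVector β) γ

/-- The largest posterior odds of a wrong model against the true model `stateVector β` for the
response `X β + ε`. -/
def maxOddsAgainstTrue {n : ℕ} (ν φ : ℝ) (X : Matrix (Fin n) (Fin n) ℝ) (β ε : Fin n → ℝ) : ℝ :=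
  maxPosteriorOdds ν (fun _ => φ) (flatPrior n) X (X *ᵥ β + ε) (stateVector β)

/-- The posterior probability of the true model `stateVector β` for the response `X β + ε`. -/
def truePosteriorProb {n : ℕ} (ν φ : ℝ) (X : Matrix (Fin n) (Fin n) ℝ) (β ε : Fin n → ℝ) : ℝ :=
  posteriorProb ν (fun _ => φ) (flatPrior n) X (X *ᵥ β + ε) (stateVector β)

variable {n : ℕ} {X : Matrix (Fin n) (Fin n) ℝ} {ν φ ψ A C M L : ℝ} {β ε : Fin n → ℝ} {j : Fin n}

theorem sq_score_response_le (hX : IsOrthogonalDesign X) (hε : |score X ε j| ≤ L) :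
    score X (X *ᵥ β + ε) j ^ 2 ≤ 2 * n * β j ^ 2 + 2 * L ^ 2 := by
  rw [hX.score_mulVec_add]
  calc (√n * β j + score X ε j) ^ 2 ≤ 2 * ((√n * β j) ^ 2 + score X ε j ^ 2) := add_sq_le
    _ = 2 * n * β j ^ 2 + 2 * score X ε j ^ 2 := by
        rw [mul_pow, Real.sq_sqrt n.cast_nonneg]
        ring
    _ ≤ 2 * n * β j ^ 2 + 2 * L ^ 2 := by
        gcongr 2 * n * β j ^ 2 + 2 * ?_
        exact sq_le_sq' (abs_le.1 hε).1 (abs_le.1 hε).2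

theorem sum_sq_score_response_le (hX : IsOrthogonalDesign X) (hε : ∀ j, |score X ε j| ≤ L)
    (γ : Finset (Fin n)) :
    ∑ j ∈ γ, score X (X *ᵥ β + ε) j ^ 2 ≤ 2 * n * ∑ j, β j ^ 2 + 2 * n * L ^ 2 := by
  calc ∑ j ∈ γ, score X (X *ᵥ β + ε) j ^ 2 ≤ ∑ j, score X (X *ᵥ β + ε) j ^ 2 :=
        Finset.sum_le_sum_of_subset_of_nonneg (Finset.subset_univ _) fun _ _ _ => sq_nonneg _
    _ ≤ ∑ j, (2 * n * β j ^ 2 + 2 * L ^ 2) :=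
        Finset.sum_le_sum fun j _ => sq_score_response_le hX (hε j)
    _ = 2 * n * ∑ j, β j ^ 2 + 2 * n * L ^ 2 := by
        rw [Finset.sum_add_distrib, ← Finset.mul_sum, Finset.sum_const, Finset.card_fin,
          nsmul_eq_mul]
        ring

theorem sq_score_response_le_of_notMem (hX : IsOrthogonalDesign X) (hε : |score X ε j| ≤ L)
    (hj : j ∉ stateVector β) : score X (X *ᵥ β + ε) j ^ 2 ≤ L ^ 2 := by
  have hβ : β j = 0 := by simpa [stateVector] using hj
  rw [hX.score_mulVec_add, hβ, mul_zero, zero_add]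
  exact sq_le_sq' (abs_le.1 hε).1 (abs_le.1 hε).2

theorem le_sq_score_response (hX : IsOrthogonalDesign X) (hε : |score X ε j| ≤ L) (hψ : 0 ≤ ψ)
    (hβ : ψ ≤ |β j|) (hL : 4 * L ^ 2 ≤ n * ψ ^ 2) :
    n * ψ ^ 2 / 4 ≤ score X (X *ᵥ β + ε) j ^ 2 := by
  have hsqrt : √n ^ 2 = n := Real.sq_sqrt n.cast_nonneg
  have hnoise : 2 * L ≤ √n * ψ := by
    refine abs_le_of_sq_le_sq' ?_ (by positivity) |>.2
    rwa [mul_pow, mul_pow, hsqrt, show (2 : ℝ) ^ 2 = 4 by norm_num]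
  have hsignal : √n * ψ ≤ |√n * β j| := by
    rw [abs_mul, abs_of_nonneg (Real.sqrt_nonneg _)]
    gcongr
  have hresponse : √n * ψ / 2 ≤ |score X (X *ᵥ β + ε) j| := by
    rw [hX.score_mulVec_add]
    linarith [abs_sub_abs_le_abs_add (√n * β j) (score X ε j)]
  calc n * ψ ^ 2 / 4 = (√n * ψ / 2) ^ 2 := by
        rw [div_pow, mul_pow, hsqrt]
        norm_num
    _ ≤ |score X (X *ᵥ β + ε) j| ^ 2 := by gcongr
    _ = _ := sq_abs _

theorem dispersion_response_le (hX : IsOrthogonalDesign X) (hn : 0 < n) (hφ : 0 < φ)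
    (hL : 1 ≤ L) (hε : ∀ j, |score X ε j| ≤ L) (hβ : ∑ j, β j ^ 2 ≤ C * ψ ^ 2)
    (hLM : L ^ 2 * (1 + n * φ) ≤ M * ψ ^ 2) :
    dispersion (n * φ) (score X (X *ᵥ β + ε)) (stateVector β) ≤
      (8 * C + 16 * M) / (1 + n * φ) * (n * ψ ^ 2 / 4) := by
  have hn : (1 : ℝ) ≤ n := Nat.one_le_cast.2 hn
  have hLsq : 1 ≤ L ^ 2 := one_le_pow₀ hL
  have ha : 1 ≤ 1 + n * φ := le_add_of_nonneg_right (by positivity)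
  have hsum := calc ∑ j ∈ stateVector β, score X (X *ᵥ β + ε) j ^ 2
      ≤ 2 * n * ∑ j, β j ^ 2 + 2 * n * L ^ 2 := sum_sq_score_response_le hX hε _
    _ ≤ 2 * n * (C * ψ ^ 2) + 2 * n * (M * ψ ^ 2) := by
        gcongr
        exact (le_mul_of_one_le_right (sq_nonneg L) ha).trans hLM
  have hnull : 1 + n * L ^ 2 ≤ 2 * n * (M * ψ ^ 2 / (1 + n * φ)) :=
    calc 1 + n * L ^ 2 ≤ n * L ^ 2 + n * L ^ 2 := by
          gcongr
          exact one_le_mul_of_one_le_of_one_le hn hLsq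
      _ = 2 * n * L ^ 2 := by ring
      _ ≤ _ := by
          gcongr
          rwa [le_div_iff₀ (by positivity)]
  calc dispersion (n * φ) (score X (X *ᵥ β + ε)) (stateVector β)
      ≤ 1 + n * L ^ 2 + (∑ j ∈ stateVector β, score X (X *ᵥ β + ε) j ^ 2) / (1 + n * φ) := by
        simpa only [Fintype.card_fin] using dispersion_le (sq_nonneg L) fun j hj =>
          sq_score_response_le_of_notMem hX (hε j) hj
    _ ≤ 2 * n * (M * ψ ^ 2 / (1 + n * φ)) +
        (2 * n * (C * ψ ^ 2) + 2 * n * (M * ψ ^ 2)) / (1 + n * φ) := by gcongr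
    _ = _ := by ring

theorem half_add_mul_div_signal_le (hn : 0 < n) (hν : 0 ≤ ν) (hψ : 0 < ψ) {b : ℝ}
    (hb : b ≤ M * ψ ^ 2) (hM : 0 ≤ M) :
    (n + ν) / 2 * (b / (n * ψ ^ 2 / 4)) ≤ 2 * M * (1 + ν) := by
  have hn : (1 : ℝ) ≤ n := Nat.one_le_cast.2 hn
  calc (n + ν) / 2 * (b / (n * ψ ^ 2 / 4)) ≤ (n + ν) / 2 * (M * ψ ^ 2 / (n * ψ ^ 2 / 4)) := by
        gcongr
    _ = 2 * M * (1 + ν / n) := by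
        field_simp
        ring
    _ ≤ 2 * M * (1 + ν) := by
        gcongr
        exact div_le_self hν hn

theorem oddsBound_oddsAgainstTrue (hX : IsOrthogonalDesign X) (hν : 0 < ν) (hφ : 0 < φ)
    (hψ : 0 ≤ ψ) (hL : 1 ≤ L) (hε : ∀ j, |score X ε j| ≤ L) (hβ : ∑ j, β j ^ 2 ≤ C * ψ ^ 2)
    (hmin : ∀ j ∈ stateVector β, ψ ≤ |β j|) (hne : (stateVector β).Nonempty) (hM : 0 < M)
    (hMn : 4 * M ≤ n) (hLM : L ^ 2 * (1 + n * φ) ≤ M * ψ ^ 2) :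
    OddsBound (oddsAgainstTrue ν φ X β ε) (stateVector β)
      (Real.exp (2 * M * (1 + ν)) * (√(1 + n * φ))⁻¹)
      (√(1 + n * φ) ^ (stateVector β).card *
        ((8 * C + 16 * M) / (1 + n * φ)) ^ ((n + ν) / 2)) := by
  have hn : 0 < n := Nat.cast_pos.1 ((by positivity : 0 < 4 * M).trans_le hMn)
  have hψ : 0 < ψ := by
    have : 0 < M * ψ ^ 2 := (by positivity : 0 < L ^ 2 * (1 + n * φ)).trans_le hLM
    exact hψ.lt_of_ne (by rintro rfl; simp at this)
  have hLψ : 4 * L ^ 2 ≤ n * ψ ^ 2 :=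
    calc 4 * L ^ 2 ≤ 4 * (L ^ 2 * (1 + n * φ)) := by
          gcongr
          exact le_mul_of_one_le_right (sq_nonneg L) (le_add_of_nonneg_right (by positivity))
      _ ≤ 4 * (M * ψ ^ 2) := by gcongr
      _ = 4 * M * ψ ^ 2 := by ring
      _ ≤ n * ψ ^ 2 := by gcongr
  have hodds := oddsBound_modelWeight (a := n * φ) (q := (n + ν) / 2) (by positivity)
    (by positivity) (by positivity : 0 < n * ψ ^ 2 / 4) (sq_nonneg L) hne
    (fun j hj => le_sq_score_response hX (hε j) hψ.le (hmin j hj) hLψ)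
    (fun j hj => sq_score_response_le_of_notMem hX (hε j) hj)
    (dispersion_response_le hX hn hφ hL hε hβ hLM)
  simp only [← posteriorOdds_eq hX hν hφ] at hodds
  refine hodds.mono (by positivity) ?_ le_rfl
  rw [mul_comm]
  gcongr ?_ * _
  refine Real.exp_le_exp.2 ?_
  exact half_add_mul_div_signal_le hn hν.le hψ hLM hM.le

theorem le_oddsAgainstTrue_empty (hX : IsOrthogonalDesign X) (hν : 0 < ν) (hφ : 0 < φ)
    (hne : (stateVector β).Nonempty) {R : ℝ} (hR : 1 + ∑ j, score X (X *ᵥ β + ε) j ^ 2 ≤ R) :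
    √(1 + n * φ) * R ^ (-((n + ν) / 2)) ≤ oddsAgainstTrue ν φ X β ε ∅ := by
  have ha : 0 ≤ n * φ := by positivity
  have hq : -((n + ν) / 2) ≤ 0 := neg_nonpos.2 (by positivity)
  have hD := one_le_dispersion ha (score X (X *ᵥ β + ε)) (stateVector β)
  rw [← dispersion_empty (n * φ)] at hR
  have hD_empty := one_le_dispersion ha (score X (X *ᵥ β + ε)) ∅
  have hsqrt : 1 ≤ √(1 + n * φ) := Real.one_le_sqrt.2 (le_add_of_nonneg_right ha)
  have htrue : modelWeight ((n + ν) / 2) (n * φ) (score X (X *ᵥ β + ε)) (stateVector β) ≤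
      (√(1 + n * φ))⁻¹ * 1 := by
    unfold modelWeight
    gcongr
    · exact pow_le_of_le_one (by positivity) (inv_le_one_of_one_le₀ hsqrt) hne.card_ne_zero
    · exact Real.rpow_le_one_of_one_le_of_nonpos hD hq
  rw [oddsAgainstTrue, posteriorOdds_eq hX hν hφ, le_div_iff₀ (modelWeight_pos ha _ _ _)]
  have hR_pow : 0 ≤ R ^ (-((n + ν) / 2)) := Real.rpow_nonneg (by linarith) _
  calc _ ≤ √(1 + n * φ) * R ^ (-((n + ν) / 2)) * ((√(1 + n * φ))⁻¹ * 1) := by gcongr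
    _ = R ^ (-((n + ν) / 2)) := by field_simp
    _ ≤ dispersion (n * φ) (score X (X *ᵥ β + ε)) ∅ ^ (-((n + ν) / 2)) :=
        Real.rpow_le_rpow_of_nonpos (by positivity) hR hq
    _ = modelWeight ((n + ν) / 2) (n * φ) (score X (X *ᵥ β + ε)) ∅ := by
        rw [modelWeight, Finset.card_empty, pow_zero, one_mul]

end Signal

section Dilution

variable {ν c η : ℝ} {s : ℕ} {φ : ℕ → ℝ} {X : (n : ℕ) → Matrix (Fin n) (Fin n) ℝ}
  {β : (n : ℕ) → Fin n → ℝ}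

theorem sqrt_one_add_mul_div {n : ℕ} (hn : n ≠ 0) (x : ℝ) :
    √(1 + n * x) / n = √(((n : ℝ) ^ 2)⁻¹ + x / n) := by
  have hn : (n : ℝ) ≠ 0 := Nat.cast_ne_zero.2 hn
  rw [show ((n : ℝ) ^ 2)⁻¹ + x / n = (1 + n * x) / (n : ℝ) ^ 2 by field_simp,
    Real.sqrt_div' _ (sq_nonneg _), Real.sqrt_sq n.cast_nonneg]

theorem tendsto_inv_natCast_sq : Tendsto (fun n : ℕ => ((n : ℝ) ^ 2)⁻¹) atTop (𝓝 0) :=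
  tendsto_inv_atTop_zero.comp ((tendsto_pow_atTop two_ne_zero).comp tendsto_natCast_atTop_atTop)

theorem tendsto_sqrt_one_add_mul_div (hφ : Tendsto (fun n : ℕ => φ n / n) atTop (𝓝 c)) :
    Tendsto (fun n : ℕ => √(1 + n * φ n) / n) atTop (𝓝 √c) := by
  have hlim := (tendsto_inv_natCast_sq.add hφ).sqrt
  rw [zero_add] at hlim
  refine hlim.congr' ?_
  filter_upwards [eventually_ne_atTop 0] with n hn using (sqrt_one_add_mul_div hn (φ n)).symm

theorem tendsto_natCast_mul_inv_sqrt (hφ : Tendsto (fun n : ℕ => φ n / n) atTop atTop) :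
    Tendsto (fun n : ℕ => n * (√(1 + n * φ n))⁻¹) atTop (𝓝 0) := by
  have hlim := tendsto_inv_atTop_zero.comp
    (Real.tendsto_sqrt_atTop.comp (tendsto_inv_natCast_sq.add_atTop hφ))
  refine hlim.congr' ?_
  filter_upwards [eventually_ne_atTop 0] with n hn
  rw [Function.comp_apply, Function.comp_apply, ← sqrt_one_add_mul_div hn, inv_div, div_eq_mul_inv]

theorem tendsto_sqrt_div_sqrt_add (s : ℕ) (hφ : Tendsto (fun n : ℕ => φ n / n) atTop (𝓝 c)) :
    Tendsto (fun n : ℕ => √(1 + n * φ n) / (√(1 + n * φ n) + (n - s))) atTop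
      (𝓝 (√c / (√c + 1))) := by
  have hsqrt := tendsto_sqrt_one_add_mul_div hφ
  have hnull : Tendsto (fun n : ℕ => 1 - (s : ℝ) / n) atTop (𝓝 1) := by
    simpa using (tendsto_const_div_atTop_nhds_zero_nat (s : ℝ)).const_sub 1
  refine (hsqrt.div (hsqrt.add hnull) (by positivity)).congr' ?_
  filter_upwards [eventually_ne_atTop 0] with n hn
  rw [Pi.div_apply, ← mul_div_mul_right _ _ (Nat.cast_ne_zero.2 hn : (n : ℝ) ≠ 0)]
  field_simp

theorem eventually_truePosteriorProb_le (hν : 0 < ν) (hφ : ∀ᶠ n in atTop, 0 < φ n)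
    (hcard : ∀ᶠ n in atTop, (stateVector (β n)).card = s) :
    ∀ᶠ n in atTop, ∀ X, IsOrthogonalDesign X → ∀ ε, truePosteriorProb ν (φ n) X (β n) ε ≤
      √(1 + n * φ n) / (√(1 + n * φ n) + (n - s)) := by
  filter_upwards [hφ, hcard] with n hφn hs X hX ε
  have hcompl : ((stateVector (β n))ᶜ.card : ℝ) = n - s := by
    rw [eq_sub_iff_add_eq', ← hs]
    exact_mod_cast (Finset.card_add_card_compl _).trans (Fintype.card_fin n)
  exact hcompl ▸ posteriorProb_le hX hν hφn _ _

theorem tendsto_truePosteriorProb_zero (hν : 0 < ν) (hφ : ∀ᶠ n in atTop, 0 < φ n)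
    (hcard : ∀ᶠ n in atTop, (stateVector (β n)).card = s)
    (hlim : Tendsto (fun n : ℕ => φ n / n) atTop (𝓝 0)) (hX : ∀ n, IsOrthogonalDesign (X n))
    (ε : (n : ℕ) → Fin n → ℝ) :
    Tendsto (fun n => truePosteriorProb ν (φ n) (X n) (β n) (ε n)) atTop (𝓝 0) := by
  have hbound := tendsto_sqrt_div_sqrt_add s hlim
  rw [Real.sqrt_zero, zero_div] at hbound
  refine squeeze_zero' ?_ ?_ hbound
  · filter_upwards [hφ] with n hφn using (posteriorProb_pos (hX n) hν hφn _ _).le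
  · filter_upwards [eventually_truePosteriorProb_le hν hφ hcard] with n hle using
      hle (X n) (hX n) (ε n)

theorem limsup_truePosteriorProb_le (hν : 0 < ν) (hφ : ∀ᶠ n in atTop, 0 < φ n)
    (hcard : ∀ᶠ n in atTop, (stateVector (β n)).card = s)
    (hlim : Tendsto (fun n : ℕ => φ n / n) atTop (𝓝 c)) (hX : ∀ n, IsOrthogonalDesign (X n))
    (ε : (n : ℕ) → Fin n → ℝ) :
    limsup (fun n => (truePosteriorProb ν (φ n) (X n) (β n) (ε n) : EReal)) atTop ≤
      ((√c / (√c + 1) : ℝ) : EReal) := by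
  rw [← ((continuous_coe_real_ereal.tendsto _).comp (tendsto_sqrt_div_sqrt_add s hlim)).limsup_eq]
  refine limsup_le_limsup ?_
  filter_upwards [eventually_truePosteriorProb_le hν hφ hcard] with n hle using
    EReal.coe_le_coe (hle (X n) (hX n) (ε n))

theorem le_liminf_maxOddsAgainstTrue (hν : 0 < ν) (hφ : ∀ᶠ n in atTop, 0 < φ n)
    (hcard : ∀ᶠ n in atTop, (stateVector (β n)).card = s) (hη : 0 ≤ η)
    (hlim : Tendsto (fun n : ℕ => n * φ n) atTop (𝓝 η)) (hX : ∀ n, IsOrthogonalDesign (X n))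
    (ε : (n : ℕ) → Fin n → ℝ) :
    (((1 + η) ^ (-(1 / 2) : ℝ) : ℝ) : EReal) ≤
      liminf (fun n => (maxOddsAgainstTrue ν (φ n) (X n) (β n) (ε n) : EReal)) atTop := by
  have hinv_sqrt : Tendsto (fun n : ℕ => (√(1 + n * φ n))⁻¹) atTop
      (𝓝 ((1 + η) ^ (-(1 / 2) : ℝ))) := by
    rw [Real.rpow_neg (by positivity), ← Real.sqrt_eq_rpow]
    exact (hlim.const_add 1).sqrt.inv₀ (by positivity)
  rw [← ((continuous_coe_real_ereal.tendsto _).comp hinv_sqrt).liminf_eq]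
  refine liminf_le_liminf ?_
  filter_upwards [hφ, hcard, eventually_gt_atTop s] with n hφn hs hsn using
    EReal.coe_le_coe (inv_sqrt_le_maxPosteriorOdds (hX n) hν hφn _ (hs ▸ hsn))

theorem tendsto_div_natCast_of_tendsto_mul
    (hlim : Tendsto (fun n : ℕ => n * φ n) atTop (𝓝 η)) :
    Tendsto (fun n : ℕ => φ n / n) atTop (𝓝 0) := by
  have h := hlim.mul tendsto_inv_natCast_sq
  rw [mul_zero] at h
  refine h.congr' ?_
  filter_upwards [eventually_ne_atTop 0] with n hn
  have hn : (n : ℝ) ≠ 0 := Nat.cast_ne_zero.2 hn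
  field_simp

end Dilution

section Typical

variable {ν k : ℝ} {s : ℕ} {φ ψ : ℕ → ℝ} {β : (n : ℕ) → Fin n → ℝ}

/-- The realisations of design and noise on which the conclusions hold in probability: the design
is orthogonal and all noise scores are at most `log n` (the scores are Gaussian with a variance
that does not depend on `n`). -/
structure IsTypical {n : ℕ} (X : Matrix (Fin n) (Fin n) ℝ) (ε : Fin n → ℝ) : Prop where
  isOrthogonalDesign : IsOrthogonalDesign X
  abs_score_le : ∀ j, |score X ε j| ≤ Real.log n

/-- A sequence of coefficient vectors with exactly `s > 0` nonzero entries, each of size at least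
`ψ n`, whose Euclidean norm has order at most `ψ n`. -/
structure IsSparseSignal (β : (n : ℕ) → Fin n → ℝ) (s : ℕ) (ψ : ℕ → ℝ) : Prop where
  pos : 0 < s
  card_eq : ∀ᶠ n in atTop, (stateVector (β n)).card = s
  nonneg : ∀ n, 0 ≤ ψ n
  le_abs : ∀ᶠ n in atTop, ∀ j ∈ stateVector (β n), ψ n ≤ |β n j|
  sum_sq_isBigO : (fun n => ∑ j, β n j ^ 2) =O[atTop] fun n => ψ n ^ 2

theorem tendsto_log_natCast : Tendsto (fun n : ℕ => Real.log n) atTop atTop :=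
  Real.tendsto_log_atTop.comp tendsto_natCast_atTop_atTop

theorem eventually_le_mul_of_isBigO {α : Type*} {l : Filter α} {f g : α → ℝ} (h : f =O[l] g)
    (hg : ∀ x, 0 ≤ g x) : ∃ C > 0, ∀ᶠ x in l, f x ≤ C * g x := by
  obtain ⟨C, hC, hbound⟩ := h.exists_pos
  refine ⟨C, hC, hbound.bound.mono fun x hx => ?_⟩
  rw [Real.norm_of_nonneg (hg x)] at hx
  exact (Real.le_norm_self _).trans hx

theorem pow_mul_div_sq_rpow_le {r K q : ℝ} {n : ℕ} (hsn : s ≤ n) (hK : 0 < K) (hr : 4 * √K ≤ r)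
    (hq : n / 2 ≤ q) : r ^ s * (K / r ^ 2) ^ q ≤ (4 * √K) ^ s * (1 / 4) ^ n := by
  have hr_pos : 0 < r := (by positivity : 0 < 4 * √K).trans_le hr
  have hratio : √K / r ≤ 1 / 4 := by
    rw [div_le_iff₀ hr_pos]
    linarith
  have hpow : (K / r ^ 2) ^ q ≤ (√K / r) ^ n :=
    calc (K / r ^ 2) ^ q = ((√K / r) ^ 2) ^ q := by rw [div_pow, Real.sq_sqrt hK.le]
      _ ≤ ((√K / r) ^ 2) ^ ((n : ℝ) / 2) := Real.rpow_le_rpow_of_exponent_ge (by positivity)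
          (pow_le_one₀ (by positivity) (hratio.trans (by norm_num))) hq
      _ = (√K / r) ^ n := by
          rw [← Real.rpow_natCast, ← Real.rpow_mul (by positivity), ← Real.rpow_natCast,
            Nat.cast_ofNat, mul_div_cancel₀ _ two_ne_zero]
  obtain ⟨m, rfl⟩ := Nat.exists_eq_add_of_le hsn
  calc r ^ s * (K / r ^ 2) ^ q ≤ r ^ s * (√K / r) ^ (s + m) := by gcongr
    _ = √K ^ s * (√K / r) ^ m := by
        rw [pow_add, div_pow √K r s, ← mul_assoc, mul_div_cancel₀ _ (by positivity)]
    _ ≤ √K ^ s * (1 / 4) ^ m := by gcongr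
    _ = (4 * √K) ^ s * (1 / 4) ^ (s + m) := by
        rw [pow_add, mul_pow, mul_comm (4 ^ s), mul_assoc, ← mul_assoc (4 ^ s), ← mul_pow]
        norm_num

theorem IsSparseSignal.exists_oddsBound (hβ : IsSparseSignal β s ψ) (hν : 0 < ν)
    (hφ : ∀ᶠ n in atTop, 0 < φ n)
    (hψ : (fun n : ℕ => Real.log n ^ 2 * (1 + n * φ n)) =O[atTop] fun n => ψ n ^ 2)
    (hlim : Tendsto (fun n : ℕ => √(1 + n * φ n)) atTop atTop) :
    ∃ C₁ > 0, ∃ C₂ > 0, ∀ᶠ n in atTop, ∀ X ε, IsTypical X ε →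
      OddsBound (oddsAgainstTrue ν (φ n) X (β n) ε) (stateVector (β n))
        (C₁ * (√(1 + n * φ n))⁻¹) (C₂ * (1 / 4) ^ n) := by
  obtain ⟨C, hC, hsum⟩ := eventually_le_mul_of_isBigO hβ.sum_sq_isBigO fun n => sq_nonneg (ψ n)
  obtain ⟨M, hM, hLM⟩ := eventually_le_mul_of_isBigO hψ fun n => sq_nonneg (ψ n)
  refine ⟨Real.exp (2 * M * (1 + ν)), Real.exp_pos _, (4 * √(8 * C + 16 * M)) ^ s,
    by positivity, ?_⟩
  filter_upwards [hβ.card_eq, hβ.le_abs, hφ, hsum, hLM, eventually_ge_atTop s,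
    tendsto_log_natCast.eventually_ge_atTop 1,
    tendsto_natCast_atTop_atTop.eventually_ge_atTop (4 * M),
    hlim.eventually_ge_atTop (4 * √(8 * C + 16 * M))]
    with n hcard hmin hφn hsum hLM hsn hlog hMn hr X ε hXε
  have hbound := oddsBound_oddsAgainstTrue hXε.isOrthogonalDesign hν hφn (hβ.nonneg n) hlog
    hXε.abs_score_le hsum hmin (Finset.card_pos.1 (hcard ▸ hβ.pos)) hM hMn hLM
  refine hbound.mono (by positivity) le_rfl ?_
  have htail := pow_mul_div_sq_rpow_le (q := (n + ν) / 2) hsn (by positivity) hr (by linarith)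
  rw [Real.sq_sqrt (by positivity)] at htail
  rwa [hcard]

theorem isBigO_one_add_mul_sum_sq (hk : 1 ≤ k)
    (hβ : (fun n => ∑ j, β n j ^ 2) =O[atTop] fun n : ℕ => (n : ℝ) ^ k) :
    (fun n : ℕ => 1 + (2 * n * ∑ j, β n j ^ 2 + 2 * n * Real.log n ^ 2)) =O[atTop]
      fun n : ℕ => n * (n : ℝ) ^ k := by
  have hle : ∀ᶠ n : ℕ in atTop, (1 : ℝ) ≤ n ∧ (n : ℝ) ≤ n ^ k := by
    filter_upwards [eventually_ge_atTop 1] with n hn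
    have hn : (1 : ℝ) ≤ n := Nat.one_le_cast.2 hn
    exact ⟨hn, Real.self_le_rpow_of_one_le hn hk⟩
  have hid : (fun n : ℕ => (n : ℝ)) =O[atTop] fun n : ℕ => (n : ℝ) ^ k := by
    refine IsBigO.of_norm_eventuallyLE (hle.mono fun n hn => ?_)
    exact (Real.norm_of_nonneg n.cast_nonneg).trans_le hn.2
  have hone : (fun _ : ℕ => (1 : ℝ)) =O[atTop] fun n : ℕ => n * (n : ℝ) ^ k := by
    refine IsBigO.of_norm_eventuallyLE (hle.mono fun n hn => ?_)
    exact norm_one.trans_le (one_le_mul_of_one_le_of_one_le hn.1 (hn.1.trans hn.2))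
  have hlog : (fun n : ℕ => Real.log n ^ 2) =O[atTop] fun n : ℕ => (n : ℝ) ^ k :=
    (Real.isLittleO_pow_log_id_atTop.isBigO.comp_tendsto tendsto_natCast_atTop_atTop).trans hid
  have htwo : (fun n : ℕ => 2 * (n : ℝ)) =O[atTop] fun n : ℕ => (n : ℝ) :=
    (isBigO_refl _ _).const_mul_left 2
  exact hone.add ((htwo.mul hβ).add (htwo.mul hlog))

theorem eventually_one_add_sum_sq_score_le (hk : 1 ≤ k)
    (hβ : (fun n => ∑ j, β n j ^ 2) =O[atTop] fun n : ℕ => (n : ℝ) ^ k) :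
    ∀ᶠ n : ℕ in atTop, ∀ X ε, IsTypical X ε →
      1 + ∑ j, score X (X *ᵥ β n + ε) j ^ 2 ≤ (n : ℝ) ^ (k + 2) := by
  obtain ⟨C, -, hbound⟩ := eventually_le_mul_of_isBigO (isBigO_one_add_mul_sum_sq hk hβ)
    fun n => by positivity
  filter_upwards [hbound, tendsto_natCast_atTop_atTop.eventually_ge_atTop C]
    with n hbound hCn X ε hXε
  have hsum := sum_sq_score_response_le (β := β n) hXε.isOrthogonalDesign hXε.abs_score_le
    Finset.univ
  calc 1 + ∑ j, score X (X *ᵥ β n + ε) j ^ 2 ≤ C * (n * (n : ℝ) ^ k) := by linarith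
    _ ≤ n * (n * (n : ℝ) ^ k) := by gcongr
    _ = (n : ℝ) ^ (k + 2) := by
        rw [Real.rpow_add' n.cast_nonneg (by positivity), Real.rpow_two]
        ring

theorem eventually_rpow_mul_log_div_two_le_sqrt
    (hφ : (fun n : ℕ => (n : ℝ) ^ ((n : ℝ) * Real.log n)) =O[atTop] φ)
    (hpos : ∀ᶠ n in atTop, 0 < φ n) :
    ∀ᶠ n : ℕ in atTop, (n : ℝ) ^ ((n : ℝ) * Real.log n / 2) ≤ √(1 + n * φ n) := by
  obtain ⟨C, -, hbound⟩ := hφ.exists_pos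
  filter_upwards [hbound.bound, hpos, tendsto_natCast_atTop_atTop.eventually_ge_atTop C]
    with n hbound hφn hCn
  rw [Real.norm_of_nonneg (by positivity), Real.norm_of_nonneg hφn.le] at hbound
  refine Real.le_sqrt_of_sq_le ?_
  calc ((n : ℝ) ^ ((n : ℝ) * Real.log n / 2)) ^ 2 = (n : ℝ) ^ ((n : ℝ) * Real.log n) := by
        rw [← Real.rpow_mul_natCast n.cast_nonneg, Nat.cast_ofNat, div_mul_cancel₀ _ two_ne_zero]
    _ ≤ n * φ n := hbound.trans (by gcongr)
    _ ≤ 1 + n * φ n := le_add_of_nonneg_left zero_le_one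

theorem eventually_natCast_le_rpow_mul_log_mul (hν : 0 < ν) (hk : 0 ≤ k) :
    ∀ᶠ n : ℕ in atTop, (n : ℝ) ≤
      (n : ℝ) ^ ((n : ℝ) * Real.log n / 2) * ((n : ℝ) ^ k) ^ (-((n + ν) / 2)) := by
  filter_upwards [eventually_ge_atTop 1, tendsto_log_natCast.eventually_ge_atTop (k + k * ν + 2)]
    with n hn hlog
  have hn : (1 : ℝ) ≤ n := Nat.one_le_cast.2 hn
  have hexp : 1 ≤ (n : ℝ) * Real.log n / 2 + k * -((n + ν) / 2) := by
    nlinarith [mul_nonneg hk hν.le]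
  calc (n : ℝ) ≤ (n : ℝ) ^ ((n : ℝ) * Real.log n / 2 + k * -((n + ν) / 2)) :=
        Real.self_le_rpow_of_one_le hn hexp
    _ = _ := by rw [Real.rpow_add (by positivity), Real.rpow_mul (by positivity)]

theorem eventually_natCast_le_oddsAgainstTrue_empty (hν : 0 < ν)
    (hne : ∀ᶠ n in atTop, (stateVector (β n)).Nonempty) (hk : 1 ≤ k)
    (hβ : (fun n => ∑ j, β n j ^ 2) =O[atTop] fun n : ℕ => (n : ℝ) ^ k)
    (hpos : ∀ᶠ n in atTop, 0 < φ n)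
    (hφ : (fun n : ℕ => (n : ℝ) ^ ((n : ℝ) * Real.log n)) =O[atTop] φ) :
    ∀ᶠ n : ℕ in atTop, ∀ X ε, IsTypical X ε →
      (n : ℝ) ≤ oddsAgainstTrue ν (φ n) X (β n) ε ∅ := by
  filter_upwards [hne, hpos, eventually_one_add_sum_sq_score_le hk hβ,
    eventually_rpow_mul_log_div_two_le_sqrt hφ hpos,
    eventually_natCast_le_rpow_mul_log_mul hν (by positivity : 0 ≤ k + 2)]
    with n hne hφn hR hsqrt hbig X ε hXε
  calc (n : ℝ) ≤ _ := hbig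
    _ ≤ √(1 + n * φ n) * ((n : ℝ) ^ (k + 2)) ^ (-((n + ν) / 2)) := by gcongr
    _ ≤ _ := le_oddsAgainstTrue_empty hXε.isOrthogonalDesign hν hφn hne (hR X ε hXε)

end Typical

section Probability

variable {Ω : Type*} [MeasurableSpace Ω] {P : Measure Ω} {G : ℕ → Ω → Prop} {f : ℕ → Ω → ℝ}
  {b : ℕ → ℝ} {a c : ℝ}

theorem tendsto_measure_zero_of_imp_not (hG : Tendsto (fun n => P {ω | ¬ G n ω}) atTop (𝓝 0))
    {A : ℕ → Set Ω} (hA : ∀ᶠ n in atTop, ∀ ω, G n ω → ω ∉ A n) :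
    Tendsto (fun n => P (A n)) atTop (𝓝 0) := by
  refine tendsto_of_tendsto_of_tendsto_of_le_of_le' tendsto_const_nhds hG
    (Eventually.of_forall fun _ => zero_le) ?_
  filter_upwards [hA] with n hn using measure_mono fun ω hω hGω => hn ω hGω hω

theorem tendstoInMeasure_of_abs_sub_le (hG : Tendsto (fun n => P {ω | ¬ G n ω}) atTop (𝓝 0))
    (hb : Tendsto b atTop (𝓝 0)) (h : ∀ᶠ n in atTop, ∀ ω, G n ω → |f n ω - c| ≤ b n) :
    TendstoInMeasure P f atTop fun _ => c := by
  refine tendstoInMeasure_iff_dist.2 fun δ hδ => tendsto_measure_zero_of_imp_not hG ?_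
  filter_upwards [h, hb.eventually_lt_const hδ] with n hn hbn ω hω
  exact not_le.2 ((hn ω hω).trans_lt hbn)

theorem tendstoInProbAtTop_of_le (hG : Tendsto (fun n => P {ω | ¬ G n ω}) atTop (𝓝 0))
    (hb : Tendsto b atTop atTop) (h : ∀ᶠ n in atTop, ∀ ω, G n ω → b n ≤ f n ω) :
    TendstoInProbAtTop P f := by
  refine fun M => tendsto_measure_zero_of_imp_not hG ?_
  filter_upwards [h, hb.eventually_gt_atTop M] with n hn hbn ω hω
  exact not_le.2 (hbn.trans_le (hn ω hω))

theorem not_tendstoInMeasure_const [NeZero P] (hb : Tendsto b atTop (𝓝 c)) (hca : c < a)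
    (h : ∀ᵐ ω ∂P, ∀ᶠ n in atTop, f n ω ≤ b n) : ¬ TendstoInMeasure P f atTop fun _ => a := by
  intro hf
  obtain ⟨ns, hns, hlim⟩ := hf.exists_seq_tendsto_ae
  obtain ⟨ω, hω, hle⟩ := (hlim.and h).exists
  exact hca.not_ge (le_of_tendsto_of_tendsto hω (hb.comp hns.tendsto_atTop)
    (hns.tendsto_atTop.eventually hle))

end Probability

section Consistency

variable {Ω : Type*} [MeasurableSpace Ω] {P : Measure Ω} {ν c k : ℝ} {s : ℕ} {φ ψ : ℕ → ℝ}
  {X : (n : ℕ) → Ω → Matrix (Fin n) (Fin n) ℝ} {ε : (n : ℕ) → Ω → Fin n → ℝ}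
  {β : (n : ℕ) → Fin n → ℝ}

theorem tendsto_const_mul_pow_zero (C : ℝ) {r : ℝ} (hr : 0 ≤ r) (hr1 : r < 1) :
    Tendsto (fun n : ℕ => C * r ^ n) atTop (𝓝 0) := by
  simpa only [mul_zero] using (tendsto_pow_atTop_nhds_zero_of_lt_one hr hr1).const_mul C

theorem tendstoInMeasure_maxOddsAgainstTrue
    (htyp : Tendsto (fun n => P {ω | ¬ IsTypical (X n ω) (ε n ω)}) atTop (𝓝 0))
    (hβ : IsSparseSignal β s ψ) (hν : 0 < ν) (hφ : ∀ᶠ n in atTop, 0 < φ n)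
    (hψ : (fun n : ℕ => Real.log n ^ 2 * (1 + n * φ n)) =O[atTop] fun n => ψ n ^ 2)
    (hlim : Tendsto (fun n : ℕ => √(1 + n * φ n)) atTop atTop) :
    TendstoInMeasure P (fun n ω => maxOddsAgainstTrue ν (φ n) (X n ω) (β n) (ε n ω)) atTop
      fun _ => 0 := by
  obtain ⟨C₁, hC₁, C₂, hC₂, hodds⟩ := hβ.exists_oddsBound hν hφ hψ hlim
  have hθ : Tendsto (fun n : ℕ => C₁ * (√(1 + n * φ n))⁻¹) atTop (𝓝 0) := by
    simpa only [mul_zero, Function.comp_def] using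
      (tendsto_inv_atTop_zero.comp hlim).const_mul C₁
  have hτ := tendsto_const_mul_pow_zero C₂ (r := 1 / 4) (by norm_num) (by norm_num)
  refine tendstoInMeasure_of_abs_sub_le htyp ((hθ.add hτ).trans_eq (by rw [add_zero])) ?_
  filter_upwards [hodds, hφ, hθ.eventually_le_const one_pos] with n hodds hφn hθ1 ω hω
  rw [sub_zero]
  exact (hodds _ _ hω).abs_maxPosteriorOdds_le hω.isOrthogonalDesign hν hφn (by positivity) hθ1
    (by positivity)

theorem tendstoInMeasure_truePosteriorProb_one
    (htyp : Tendsto (fun n => P {ω | ¬ IsTypical (X n ω) (ε n ω)}) atTop (𝓝 0))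
    (hβ : IsSparseSignal β s ψ) (hν : 0 < ν) (hφ : ∀ᶠ n in atTop, 0 < φ n)
    (hψ : (fun n : ℕ => Real.log n ^ 2 * (1 + n * φ n)) =O[atTop] fun n => ψ n ^ 2)
    (hlim : Tendsto (fun n : ℕ => √(1 + n * φ n)) atTop atTop)
    (hratio : Tendsto (fun n : ℕ => φ n / n) atTop atTop) :
    TendstoInMeasure P (fun n ω => truePosteriorProb ν (φ n) (X n ω) (β n) (ε n ω)) atTop
      fun _ => 1 := by
  obtain ⟨C₁, hC₁, C₂, hC₂, hodds⟩ := hβ.exists_oddsBound hν hφ hψ hlim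
  have hsupersets : Tendsto (fun n : ℕ => Real.exp (n * (C₁ * (√(1 + n * φ n))⁻¹)) - 1) atTop
      (𝓝 0) := by
    have h := (tendsto_natCast_mul_inv_sqrt hratio).const_mul C₁
    rw [mul_zero] at h
    simpa only [Real.exp_zero, sub_self, mul_left_comm, Function.comp_def] using
      ((Real.continuous_exp.tendsto 0).comp h).sub_const 1
  have hothers : Tendsto (fun n : ℕ => 2 ^ n * (C₂ * (1 / 4) ^ n)) atTop (𝓝 0) := by
    refine (tendsto_const_mul_pow_zero C₂ (r := 2 * (1 / 4)) (by norm_num) (by norm_num)).congr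
      fun n => ?_
    rw [mul_pow, mul_left_comm]
  refine tendstoInMeasure_of_abs_sub_le htyp
    ((hsupersets.add hothers).trans_eq (by rw [add_zero])) ?_
  filter_upwards [hodds, hφ] with n hodds hφn ω hω
  exact (hodds _ _ hω).abs_posteriorProb_sub_one_le hω.isOrthogonalDesign hν hφn (by positivity)
    (by positivity)

theorem not_tendstoInMeasure_truePosteriorProb_one [NeZero P] (hν : 0 < ν)
    (hφ : ∀ᶠ n in atTop, 0 < φ n) (hcard : ∀ᶠ n in atTop, (stateVector (β n)).card = s)
    (hlim : Tendsto (fun n : ℕ => φ n / n) atTop (𝓝 c))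
    (hX : ∀ᵐ ω ∂P, ∀ n, IsOrthogonalDesign (X n ω)) :
    ¬ TendstoInMeasure P (fun n ω => truePosteriorProb ν (φ n) (X n ω) (β n) (ε n ω)) atTop
      fun _ => 1 := by
  refine not_tendstoInMeasure_const (tendsto_sqrt_div_sqrt_add s hlim)
    ((div_lt_one (by positivity)).2 (lt_add_one _)) ?_
  filter_upwards [hX] with ω hω
  filter_upwards [eventually_truePosteriorProb_le hν hφ hcard] with n hle using
    hle (X n ω) (hω n) (ε n ω)

theorem tendstoInProbAtTop_oddsAgainstTrue_empty
    (htyp : Tendsto (fun n => P {ω | ¬ IsTypical (X n ω) (ε n ω)}) atTop (𝓝 0)) (hν : 0 < ν)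
    (hne : ∀ᶠ n in atTop, (stateVector (β n)).Nonempty) (hk : 1 ≤ k)
    (hβ : (fun n => ∑ j, β n j ^ 2) =O[atTop] fun n : ℕ => (n : ℝ) ^ k)
    (hpos : ∀ᶠ n in atTop, 0 < φ n)
    (hφ : (fun n : ℕ => (n : ℝ) ^ ((n : ℝ) * Real.log n)) =O[atTop] φ) :
    TendstoInProbAtTop P fun n ω => oddsAgainstTrue ν (φ n) (X n ω) (β n) (ε n ω) ∅ :=
  tendstoInProbAtTop_of_le htyp tendsto_natCast_atTop_atTop <|
    (eventually_natCast_le_oddsAgainstTrue_empty hν hne hk hβ hpos hφ).mono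
      fun _ hodds _ hω => hodds _ _ hω

theorem tendstoInMeasure_truePosteriorProb_zero
    (htyp : Tendsto (fun n => P {ω | ¬ IsTypical (X n ω) (ε n ω)}) atTop (𝓝 0)) (hν : 0 < ν)
    (hne : ∀ᶠ n in atTop, (stateVector (β n)).Nonempty) (hk : 1 ≤ k)
    (hβ : (fun n => ∑ j, β n j ^ 2) =O[atTop] fun n : ℕ => (n : ℝ) ^ k)
    (hpos : ∀ᶠ n in atTop, 0 < φ n)
    (hφ : (fun n : ℕ => (n : ℝ) ^ ((n : ℝ) * Real.log n)) =O[atTop] φ) :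
    TendstoInMeasure P (fun n ω => truePosteriorProb ν (φ n) (X n ω) (β n) (ε n ω)) atTop
      fun _ => 0 := by
  refine tendstoInMeasure_of_abs_sub_le htyp
    (tendsto_inv_atTop_zero.comp tendsto_natCast_atTop_atTop) ?_
  filter_upwards [eventually_natCast_le_oddsAgainstTrue_empty hν hne hk hβ hpos hφ, hpos,
    eventually_gt_atTop 0] with n hodds hφn hn ω hω
  rw [sub_zero, truePosteriorProb, abs_of_pos (posteriorProb_pos hω.isOrthogonalDesign hν hφn _ _)]
  exact (posteriorProb_le_inv_posteriorOdds hω.isOrthogonalDesign hν hφn _ _ ∅).trans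
    (inv_anti₀ (Nat.cast_pos.2 hn) (hodds _ _ hω))

end Consistency

section Noise

open scoped NNReal

theorem hasSubgaussianMGF_id_gaussianReal (v : ℝ≥0) :
    HasSubgaussianMGF id v (gaussianReal 0 v) where
  integrable_exp_mul := integrable_exp_mul_gaussianReal
  mgf_le t := by simp [mgf_id_gaussianReal]

theorem IsOrthogonalDesign.hasSubgaussianMGF_score {n p : ℕ} {X : Matrix (Fin n) (Fin p) ℝ}
    (hX : IsOrthogonalDesign X) (hn : n ≠ 0) (v : ℝ≥0) (j : Fin p) :
    HasSubgaussianMGF (fun e => score X e j) v (Measure.pi fun _ => gaussianReal 0 v) := by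
  have hunit : ∑ i, ((√n)⁻¹ * X i j) ^ 2 = 1 := by
    simp only [mul_pow, inv_pow, Real.sq_sqrt (Nat.cast_nonneg n), ← Finset.mul_sum,
      hX.sum_col_sq]
    exact inv_mul_cancel₀ (Nat.cast_ne_zero.2 hn)
  have hcoord (i : Fin n) : HasSubgaussianMGF (fun e : Fin n → ℝ => e i) v
      (Measure.pi fun _ => gaussianReal 0 v) := by
    refine .of_map (X := id) (measurable_pi_apply i).aemeasurable ?_
    rw [(measurePreserving_eval (fun _ => gaussianReal 0 v) i).map_eq]
    exact hasSubgaussianMGF_id_gaussianReal v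
  have hsum := HasSubgaussianMGF.sum_of_iIndepFun
    (iIndepFun_pi (X := fun i t => (√n)⁻¹ * X i j * t) (μ := fun _ => gaussianReal 0 v)
      fun i => (measurable_const_mul _).aemeasurable)
    (s := Finset.univ) fun i _ => (hcoord i).const_mul ((√n)⁻¹ * X i j)
  convert hsum using 1
  · exact funext fun e => score_apply X e j
  · refine NNReal.eq ?_
    rw [NNReal.coe_sum]
    calc (v : ℝ) = ∑ i, ((√n)⁻¹ * X i j) ^ 2 * v := by rw [← Finset.sum_mul, hunit, one_mul]
      _ = _ := rfl

theorem measure_lt_abs_le_of_hasSubgaussianMGF {Ω : Type*} [MeasurableSpace Ω] {μ : Measure Ω}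
    [IsFiniteMeasure μ] {Y : Ω → ℝ} {v : ℝ≥0} (hY : HasSubgaussianMGF Y v μ) {L : ℝ} (hL : 0 ≤ L) :
    μ {ω | L < |Y ω|} ≤ ENNReal.ofReal (2 * Real.exp (-L ^ 2 / (2 * v))) := by
  have hsub : {ω | L < |Y ω|} ⊆ {ω | L ≤ Y ω} ∪ {ω | L ≤ (-Y) ω} :=
    fun ω (hω : L < |Y ω|) => (lt_abs.1 hω).imp le_of_lt le_of_lt
  refine ENNReal.le_ofReal_iff_toReal_le (measure_ne_top _ _) (by positivity) |>.2 ?_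
  calc μ.real {ω | L < |Y ω|} ≤ μ.real {ω | L ≤ Y ω} + μ.real {ω | L ≤ (-Y) ω} :=
        (measureReal_mono hsub).trans (measureReal_union_le _ _)
    _ ≤ _ := by
        rw [two_mul]
        exact add_le_add (hY.measure_ge_le hL) (hY.neg.measure_ge_le hL)

theorem IsOrthogonalDesign.measure_exists_lt_abs_score_le {n p : ℕ}
    {X : Matrix (Fin n) (Fin p) ℝ} (hX : IsOrthogonalDesign X) (hn : n ≠ 0) (v : ℝ≥0) {L : ℝ}
    (hL : 0 ≤ L) :
    (Measure.pi fun _ => gaussianReal 0 v) {e | ∃ j, L < |score X e j|} ≤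
      ENNReal.ofReal (p * (2 * Real.exp (-L ^ 2 / (2 * v)))) := by
  rw [Set.ofPred_exists]
  calc _ ≤ ∑ j : Fin p, (Measure.pi fun _ => gaussianReal 0 v) {e | L < |score X e j|} :=
        measure_iUnion_fintype_le _ _
    _ ≤ ∑ _j : Fin p, ENNReal.ofReal (2 * Real.exp (-L ^ 2 / (2 * v))) :=
        Finset.sum_le_sum fun j _ =>
          measure_lt_abs_le_of_hasSubgaussianMGF (hX.hasSubgaussianMGF_score hn v j) hL
    _ = _ := by
        rw [Finset.sum_const, Finset.card_univ, Fintype.card_fin, nsmul_eq_mul,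
          ENNReal.ofReal_mul (Nat.cast_nonneg p), ENNReal.ofReal_natCast]

theorem measure_preimage_prodMk_le_of_indepFun {Ω E F : Type*} [MeasurableSpace Ω]
    [MeasurableSpace E] [MeasurableSpace F] {P : Measure Ω} [IsProbabilityMeasure P] {ξ : Ω → E}
    {ε : Ω → F} {μ : Measure F} (hξ : Measurable ξ) (hε : HasLaw ε μ P) (hindep : IndepFun ξ ε P)
    {S : Set (E × F)} (hS : MeasurableSet S) {b : ENNReal}
    (h : ∀ᵐ ω ∂P, μ (Prod.mk (ξ ω) ⁻¹' S) ≤ b) : P ((fun ω => (ξ ω, ε ω)) ⁻¹' S) ≤ b := by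
  have := hε.isProbabilityMeasure_iff.1 ‹_›
  have := Measure.isProbabilityMeasure_map (μ := P) hξ.aemeasurable
  have hlaw := hindep.hasLaw_prod (μ := P.map ξ) ⟨hξ.aemeasurable, rfl⟩ hε
  rw [← Measure.map_apply_of_aemeasurable hlaw.aemeasurable hS, hlaw.map_eq,
    Measure.prod_apply hS, lintegral_map (measurable_measure_prodMk_left hS) hξ]
  exact lintegral_le_const h

theorem measure_not_isTypical_le {Ω : Type*} [MeasurableSpace Ω] {P : Measure Ω}
    [IsProbabilityMeasure P] {n : ℕ} (hn : n ≠ 0) {X : Ω → Matrix (Fin n) (Fin n) ℝ}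
    {ε : Ω → Fin n → ℝ} {v : ℝ≥0} (hXmeas : ∀ i j, Measurable fun ω => X ω i j)
    (hX : ∀ᵐ ω ∂P, IsOrthogonalDesign (X ω))
    (hε : HasLaw ε (Measure.pi fun _ => gaussianReal 0 v) P)
    (hindep : IndepFun (fun ω (i j : Fin n) => X ω i j) ε P) :
    P {ω | ¬ IsTypical (X ω) (ε ω)} ≤
      ENNReal.ofReal (n * (2 * Real.exp (-Real.log n ^ 2 / (2 * v)))) := by
  let S : Set ((Fin n → Fin n → ℝ) × (Fin n → ℝ)) :=
    {z | ∃ j, Real.log n < |score (Matrix.of z.1) z.2 j|}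
  have hS : MeasurableSet S := by
    simp only [S, Set.ofPred_exists]
    exact .iUnion fun j => measurableSet_lt measurable_const (measurable_score j).abs
  calc P {ω | ¬ IsTypical (X ω) (ε ω)}
      ≤ P ((fun ω => ((fun i j => X ω i j), ε ω)) ⁻¹' S) := by
        refine measure_mono_ae ?_
        filter_upwards [hX] with ω hω hnot
        by_contra hmem
        refine hnot ⟨hω, fun j => not_lt.1 fun hj => hmem ⟨j, hj⟩⟩
    _ ≤ _ := by
        refine measure_preimage_prodMk_le_of_indepFun (measurable_pi_lambda _ fun i =>
          measurable_pi_lambda _ fun j => hXmeas i j) hε hindep hS ?_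
        filter_upwards [hX] with ω hω
        exact hω.measure_exists_lt_abs_score_le hn v (Real.log_natCast_nonneg n)

theorem tendsto_natCast_mul_exp_neg_log_sq {v : ℝ} (hv : 0 < v) :
    Tendsto (fun n : ℕ => n * (2 * Real.exp (-Real.log n ^ 2 / (2 * v)))) atTop (𝓝 0) := by
  have hexponent : Tendsto (fun n : ℕ => Real.log n * (1 - Real.log n / (2 * v))) atTop atBot :=
    tendsto_log_natCast.atTop_mul_atBot₀ <|
      tendsto_atBot_add_const_left _ 1 <| tendsto_neg_atTop_atBot.comp <|
        tendsto_log_natCast.atTop_div_const (by positivity)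
  have h := (Real.tendsto_exp_atBot.comp hexponent).const_mul 2
  rw [mul_zero] at h
  refine h.congr' ?_
  filter_upwards [eventually_gt_atTop 0] with n hn
  rw [Function.comp_apply, mul_left_comm]
  nth_rewrite 3 [← Real.exp_log (Nat.cast_pos.2 hn : (0 : ℝ) < n)]
  rw [← Real.exp_add]
  ring_nf

theorem tendsto_measure_not_isTypical {Ω : Type*} [MeasurableSpace Ω] {P : Measure Ω}
    [IsProbabilityMeasure P] {X : (n : ℕ) → Ω → Matrix (Fin n) (Fin n) ℝ}
    {ε : (n : ℕ) → Ω → Fin n → ℝ} {v : ℝ≥0} (hv : 0 < v)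
    (hXmeas : ∀ n i j, Measurable fun ω => X n ω i j)
    (hX : ∀ n, ∀ᵐ ω ∂P, IsOrthogonalDesign (X n ω))
    (hε : ∀ n, HasLaw (ε n) (Measure.pi fun _ => gaussianReal 0 v) P)
    (hindep : ∀ n, IndepFun (fun ω (i j : Fin n) => X n ω i j) (ε n) P) :
    Tendsto (fun n => P {ω | ¬ IsTypical (X n ω) (ε n ω)}) atTop (𝓝 0) := by
  have hbound := ENNReal.tendsto_ofReal (tendsto_natCast_mul_exp_neg_log_sq (NNReal.coe_pos.2 hv))
  rw [ENNReal.ofReal_zero] at hbound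
  refine tendsto_of_tendsto_of_tendsto_of_le_of_le' tendsto_const_nhds hbound
    (Eventually.of_forall fun _ => zero_le) ?_
  filter_upwards [eventually_ne_atTop 0] with n hn using
    measure_not_isTypical_le hn (hXmeas n) (hX n) (hε n) (hindep n)

end Noise

section PowerScale

variable {c₁ c₂ δ₁ δ₂ : ℝ} {φ ψ : ℕ → ℝ}

theorem eventually_pos_of_eventuallyEq_rpow (hc₂ : 0 < c₂)
    (hφ : ∀ᶠ n : ℕ in atTop, φ n = c₂ * (n : ℝ) ^ δ₂) : ∀ᶠ n in atTop, 0 < φ n := by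
  filter_upwards [hφ, eventually_gt_atTop 0] with n hφn hn
  rw [hφn]
  positivity

theorem div_natCast_eventuallyEq_rpow (hφ : ∀ᶠ n : ℕ in atTop, φ n = c₂ * (n : ℝ) ^ δ₂) :
    (fun n : ℕ => φ n / n) =ᶠ[atTop] fun n => c₂ * (n : ℝ) ^ (δ₂ - 1) := by
  filter_upwards [hφ, eventually_ne_atTop 0] with n hφn hn
  rw [hφn, Real.rpow_sub_one (Nat.cast_ne_zero.2 hn), mul_div_assoc]

theorem tendsto_const_mul_natCast_rpow_atTop (hc₂ : 0 < c₂) (hδ₂ : 0 < δ₂) :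
    Tendsto (fun n : ℕ => c₂ * (n : ℝ) ^ δ₂) atTop atTop :=
  ((tendsto_rpow_atTop hδ₂).comp tendsto_natCast_atTop_atTop).const_mul_atTop hc₂

theorem tendsto_div_natCast_atTop (hc₂ : 0 < c₂)
    (hφ : ∀ᶠ n : ℕ in atTop, φ n = c₂ * (n : ℝ) ^ δ₂) (hδ₂ : 1 < δ₂) :
    Tendsto (fun n : ℕ => φ n / n) atTop atTop :=
  (tendsto_const_mul_natCast_rpow_atTop hc₂ (sub_pos.2 hδ₂)).congr'
    (div_natCast_eventuallyEq_rpow hφ).symm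

theorem tendsto_div_natCast_const (hφ : ∀ᶠ n : ℕ in atTop, φ n = c₂ * (n : ℝ) ^ (1 : ℝ)) :
    Tendsto (fun n : ℕ => φ n / n) atTop (𝓝 c₂) := by
  refine tendsto_const_nhds.congr' (EventuallyEq.symm ?_)
  simpa only [sub_self, Real.rpow_zero, mul_one] using div_natCast_eventuallyEq_rpow hφ

theorem tendsto_div_natCast_zero (hφ : ∀ᶠ n : ℕ in atTop, φ n = c₂ * (n : ℝ) ^ δ₂)
    (hδ₂ : δ₂ < 1) : Tendsto (fun n : ℕ => φ n / n) atTop (𝓝 0) := by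
  have h := ((tendsto_rpow_neg_atTop (sub_pos.2 hδ₂)).comp tendsto_natCast_atTop_atTop).const_mul c₂
  rw [mul_zero] at h
  refine h.congr' (EventuallyEq.symm ?_)
  simpa only [neg_sub, Function.comp_apply] using div_natCast_eventuallyEq_rpow hφ

theorem natCast_mul_eventuallyEq_rpow (hφ : ∀ᶠ n : ℕ in atTop, φ n = c₂ * (n : ℝ) ^ δ₂) :
    (fun n : ℕ => n * φ n) =ᶠ[atTop] fun n => c₂ * (n : ℝ) ^ (1 + δ₂) := by
  filter_upwards [hφ, eventually_gt_atTop 0] with n hφn hn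
  rw [hφn, Real.rpow_add (Nat.cast_pos.2 hn), Real.rpow_one, mul_left_comm]

theorem tendsto_sqrt_one_add_mul_atTop (hc₂ : 0 < c₂)
    (hφ : ∀ᶠ n : ℕ in atTop, φ n = c₂ * (n : ℝ) ^ δ₂) (hδ₂ : -1 < δ₂) :
    Tendsto (fun n : ℕ => √(1 + n * φ n)) atTop atTop :=
  Real.tendsto_sqrt_atTop.comp <| tendsto_atTop_add_const_left _ 1 <|
    (tendsto_const_mul_natCast_rpow_atTop hc₂ (by linarith)).congr'
      (natCast_mul_eventuallyEq_rpow hφ).symm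

theorem natCast_rpow_isBigO_of_le (h : δ₂ ≤ δ₁) :
    (fun n : ℕ => (n : ℝ) ^ δ₂) =O[atTop] fun n : ℕ => (n : ℝ) ^ δ₁ := by
  refine IsBigO.of_bound' ?_
  filter_upwards [eventually_ge_atTop 1] with n hn
  rw [Real.norm_of_nonneg (by positivity), Real.norm_of_nonneg (by positivity)]
  exact Real.rpow_le_rpow_of_exponent_le (Nat.one_le_cast.2 hn) h

theorem log_sq_mul_one_add_mul_isBigO (hc₁ : c₁ ≠ 0) (hδ₁ : -1 ≤ δ₁) (hδ : δ₂ ≤ δ₁)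
    (hφ : ∀ᶠ n : ℕ in atTop, φ n = c₂ * (n : ℝ) ^ δ₂)
    (hψ : ∀ n : ℕ, ψ n ^ 2 = c₁ * (n : ℝ) ^ (1 + δ₁) * Real.log n ^ 2) :
    (fun n : ℕ => Real.log n ^ 2 * (1 + n * φ n)) =O[atTop] fun n => ψ n ^ 2 := by
  have hone : (fun _ : ℕ => (1 : ℝ)) =O[atTop] fun n : ℕ => (n : ℝ) ^ (1 + δ₁) := by
    simpa only [Real.rpow_zero] using natCast_rpow_isBigO_of_le (by linarith : 0 ≤ 1 + δ₁)
  have hmul : (fun n : ℕ => n * φ n) =O[atTop] fun n : ℕ => (n : ℝ) ^ (1 + δ₁) :=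
    (natCast_mul_eventuallyEq_rpow hφ).trans_isBigO <|
      (natCast_rpow_isBigO_of_le (by linarith)).const_mul_left c₂
  have hc : (fun n : ℕ => (n : ℝ) ^ (1 + δ₁)) =O[atTop] fun n : ℕ => c₁ * (n : ℝ) ^ (1 + δ₁) :=
    isBigO_self_const_mul hc₁ _ _
  simpa only [hψ, mul_comm] using
    (isBigO_refl (fun n : ℕ => Real.log n ^ 2) atTop).mul ((hone.add hmul).trans hc)

theorem sq_isBigO_rpow (hψ : ∀ n : ℕ, ψ n ^ 2 = c₁ * (n : ℝ) ^ (1 + δ₁) * Real.log n ^ 2) :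
    (fun n => ψ n ^ 2) =O[atTop] fun n : ℕ => (n : ℝ) ^ (3 + δ₁) := by
  have hlog : (fun n : ℕ => Real.log n ^ 2) =O[atTop] fun n : ℕ => (n : ℝ) ^ 2 :=
    (Real.isLittleO_log_id_atTop.isBigO.comp_tendsto tendsto_natCast_atTop_atTop).pow 2
  refine (((isBigO_refl (fun n : ℕ => (n : ℝ) ^ (1 + δ₁)) atTop).const_mul_left c₁).mul
    hlog).congr' (.of_forall fun n => (hψ n).symm) ?_
  filter_upwards [eventually_gt_atTop 0] with n hn
  rw [← Real.rpow_add_natCast (Nat.cast_ne_zero.2 hn.ne')]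
  congr 1
  push_cast
  ring

variable {Ω : Type*} [MeasurableSpace Ω] {P : Measure Ω} {ν : ℝ} {s : ℕ}
  {X : (n : ℕ) → Ω → Matrix (Fin n) (Fin n) ℝ} {ε : (n : ℕ) → Ω → Fin n → ℝ}
  {β : (n : ℕ) → Fin n → ℝ}

theorem tendstoInMeasure_maxOddsAgainstTrue_of_rpow
    (htyp : Tendsto (fun n => P {ω | ¬ IsTypical (X n ω) (ε n ω)}) atTop (𝓝 0))
    (hβ : IsSparseSignal β s ψ) (hν : 0 < ν) (hc₁ : c₁ ≠ 0) (hc₂ : 0 < c₂)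
    (hψ : ∀ n : ℕ, ψ n ^ 2 = c₁ * (n : ℝ) ^ (1 + δ₁) * Real.log n ^ 2)
    (hφ : ∀ᶠ n : ℕ in atTop, φ n = c₂ * (n : ℝ) ^ δ₂) (hδ₂ : -1 < δ₂) (hδ : δ₂ ≤ δ₁) :
    TendstoInMeasure P (fun n ω => maxOddsAgainstTrue ν (φ n) (X n ω) (β n) (ε n ω)) atTop
      fun _ => 0 :=
  tendstoInMeasure_maxOddsAgainstTrue htyp hβ hν (eventually_pos_of_eventuallyEq_rpow hc₂ hφ)
    (log_sq_mul_one_add_mul_isBigO hc₁ (hδ₂.le.trans hδ) hδ hφ hψ)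
    (tendsto_sqrt_one_add_mul_atTop hc₂ hφ hδ₂)

theorem tendstoInMeasure_truePosteriorProb_one_of_rpow
    (htyp : Tendsto (fun n => P {ω | ¬ IsTypical (X n ω) (ε n ω)}) atTop (𝓝 0))
    (hβ : IsSparseSignal β s ψ) (hν : 0 < ν) (hc₁ : c₁ ≠ 0) (hc₂ : 0 < c₂)
    (hψ : ∀ n : ℕ, ψ n ^ 2 = c₁ * (n : ℝ) ^ (1 + δ₁) * Real.log n ^ 2)
    (hφ : ∀ᶠ n : ℕ in atTop, φ n = c₂ * (n : ℝ) ^ δ₂) (hδ₂ : 1 < δ₂) (hδ : δ₂ ≤ δ₁) :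
    TendstoInMeasure P (fun n ω => truePosteriorProb ν (φ n) (X n ω) (β n) (ε n ω)) atTop
      fun _ => 1 :=
  tendstoInMeasure_truePosteriorProb_one htyp hβ hν (eventually_pos_of_eventuallyEq_rpow hc₂ hφ)
    (log_sq_mul_one_add_mul_isBigO hc₁ (by linarith) hδ hφ hψ)
    (tendsto_sqrt_one_add_mul_atTop hc₂ hφ (by linarith)) (tendsto_div_natCast_atTop hc₂ hφ hδ₂)

theorem not_tendstoInMeasure_truePosteriorProb_one_of_rpow [NeZero P] (hν : 0 < ν) (hc₂ : 0 < c₂)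
    (hcard : ∀ᶠ n in atTop, (stateVector (β n)).card = s)
    (hφ : ∀ᶠ n : ℕ in atTop, φ n = c₂ * (n : ℝ) ^ δ₂) (hδ₂ : δ₂ ≤ 1)
    (hX : ∀ᵐ ω ∂P, ∀ n, IsOrthogonalDesign (X n ω)) :
    ¬ TendstoInMeasure P (fun n ω => truePosteriorProb ν (φ n) (X n ω) (β n) (ε n ω)) atTop
      fun _ => 1 := by
  have hpos := eventually_pos_of_eventuallyEq_rpow hc₂ hφ
  obtain hlt | rfl := hδ₂.lt_or_eq
  · exact not_tendstoInMeasure_truePosteriorProb_one hν hpos hcard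
      (tendsto_div_natCast_zero hφ hlt) hX
  · exact not_tendstoInMeasure_truePosteriorProb_one hν hpos hcard
      (tendsto_div_natCast_const hφ) hX

end PowerScale

end BVS

end

theorem mainTheorem2 {Ω : Type*} [MeasurableSpace Ω] (P : Measure Ω) [IsProbabilityMeasure P]
    (ν σ₀ c₁ δ₁ : ℝ) (hν : 0 < ν) (hσ₀ : 0 < σ₀) (hc₁ : 0 < c₁) (hδ₁ : 1 < δ₁)
    (s : ℕ) (hs : 0 < s)
    -- the design, possibly random, with `p = n` and `XᵀX = n I`
    (X : (n : ℕ) → Ω → Matrix (Fin n) (Fin n) ℝ)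
    (hXmeas : ∀ n i j, Measurable fun ω => X n ω i j)
    (hX : ∀ n, ∀ᵐ ω ∂P, (X n ω)ᵀ * X n ω = (n : ℝ) • (1 : Matrix (Fin n) (Fin n) ℝ))
    -- the errors, with law `N(0, σ₀² I_n)`, independent of the design
    (ε : (n : ℕ) → Ω → Fin n → ℝ)
    (hε : ∀ n, HasLaw (ε n) (Measure.pi fun _ => gaussianReal 0 (σ₀ ^ 2).toNNReal) P)
    (hindep : ∀ n, IndepFun (fun ω (i j : Fin n) => X n ω i j) (ε n) P)
    -- the true coefficients
    (β₀ : (n : ℕ) → Fin n → ℝ)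
    (hcard : ∀ᶠ n in atTop, (BVS.stateVector (β₀ n)).card = s)
    (ψ : ℕ → ℝ) (hψ_nonneg : ∀ n, 0 ≤ ψ n)
    (hψ : ∀ n : ℕ, ψ n ^ 2 = c₁ * (n : ℝ) ^ (1 + δ₁) * Real.log n ^ 2)
    (hβ₀ : ∀ᶠ n in atTop, ∀ j ∈ BVS.stateVector (β₀ n), ψ n ≤ |β₀ n j|)
    (hk : (fun n => ∑ j, β₀ n j ^ 2) =O[atTop] fun n => ψ n ^ 2)
    -- the responses
    (y : (n : ℕ) → Ω → Fin n → ℝ) (hy : ∀ n ω, y n ω = X n ω *ᵥ β₀ n + ε n ω)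
    -- `post φ n ω γ = p(γ | Z)`, `odds φ n ω γ = p(γ | Z) / p(γ⁰ | Z)` and
    -- `maxOdds φ n ω = max_{γ ≠ γ⁰} p(γ | Z) / p(γ⁰ | Z)` when `Σ = φ n • I` and the prior is flat
    (post odds : (ℕ → ℝ) → (n : ℕ) → Ω → Finset (Fin n) → ℝ)
    (hpost : post = fun φ n ω γ =>
      BVS.posteriorProb ν (fun _ => φ n) (BVS.flatPrior n) (X n ω) (y n ω) γ)
    (hodds : odds = fun φ n ω γ =>
      BVS.posteriorOdds ν (fun _ => φ n) (BVS.flatPrior n) (X n ω) (y n ω)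
        (BVS.stateVector (β₀ n)) γ)
    (maxOdds : (ℕ → ℝ) → ℕ → Ω → ℝ)
    (hmaxOdds : maxOdds = fun φ n ω =>
      BVS.maxPosteriorOdds ν (fun _ => φ n) (BVS.flatPrior n) (X n ω) (y n ω)
        (BVS.stateVector (β₀ n))) :
    -- (a)
    (∀ (c₂ δ₂ : ℝ) (φ : ℕ → ℝ), 0 < c₂ → (∀ n : ℕ, 1 ≤ n → φ n = c₂ * (n : ℝ) ^ δ₂) →
      -- i.
      (-1 < δ₂ → δ₂ ≤ 1 →
        TendstoInMeasure P (maxOdds φ) atTop (fun _ => 0) ∧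
        ¬ TendstoInMeasure P (fun n ω => post φ n ω (BVS.stateVector (β₀ n))) atTop (fun _ => 1) ∧
        (δ₂ < 1 → ∀ᵐ ω ∂P,
          Tendsto (fun n => post φ n ω (BVS.stateVector (β₀ n))) atTop (𝓝 0)) ∧
        (δ₂ = 1 → ∃ c₀ : ℝ, 0 < c₀ ∧ c₀ < 1 ∧ ∀ᵐ ω ∂P,
          limsup (fun n => (post φ n ω (BVS.stateVector (β₀ n)) : EReal)) atTop ≤ (c₀ : EReal))) ∧
      -- ii.
      (1 < δ₂ → δ₂ ≤ δ₁ →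
        TendstoInMeasure P (fun n ω => post φ n ω (BVS.stateVector (β₀ n))) atTop (fun _ => 1))) ∧
    -- (b)
    (∀ φ : ℕ → ℝ, (∀ n, 1 ≤ n → 0 < φ n) →
      (fun n : ℕ => (n : ℝ) ^ ((n : ℝ) * Real.log n)) =O[atTop] φ →
      BVS.TendstoInProbAtTop P (fun n ω => odds φ n ω ∅) ∧
      TendstoInMeasure P (fun n ω => post φ n ω (BVS.stateVector (β₀ n))) atTop (fun _ => 0)) ∧
    -- (c)
    (∀ (φ : ℕ → ℝ) (η : ℝ), (∀ n, 1 ≤ n → 0 < φ n) → 0 ≤ η →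
      Tendsto (fun n : ℕ => (n : ℝ) * φ n) atTop (𝓝 η) →
      ∀ᵐ ω ∂P,
        (((1 + η) ^ (-(1 / 2) : ℝ) : ℝ) : EReal) ≤
          liminf (fun n => (maxOdds φ n ω : EReal)) atTop ∧
        Tendsto (fun n => post φ n ω (BVS.stateVector (β₀ n))) atTop (𝓝 0)) := by
  obtain rfl : y = fun n ω => X n ω *ᵥ β₀ n + ε n ω := funext₂ hy
  subst hpost hodds hmaxOdds
  have hdesign : ∀ᵐ ω ∂P, ∀ n, BVS.IsOrthogonalDesign (X n ω) := ae_all_iff.2 hX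
  have htyp := BVS.tendsto_measure_not_isTypical (Real.toNNReal_pos.2 (sq_pos_of_pos hσ₀)) hXmeas hX
    hε hindep
  have hsignal : BVS.IsSparseSignal β₀ s ψ := ⟨hs, hcard, hψ_nonneg, hβ₀, hk⟩
  have hne := hcard.mono fun n hn => Finset.card_pos.1 (hn ▸ hs)
  refine ⟨fun c₂ δ₂ φ hc₂ hφ => ?_, fun φ hpos hφ => ?_, fun φ η hpos hη hlim => ?_⟩
  · replace hφ := (eventually_ge_atTop 1).mono hφ
    have hpos := BVS.eventually_pos_of_eventuallyEq_rpow hc₂ hφ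
    refine ⟨fun hδ₂ hδ₂' => ⟨?_, ?_, fun hlt => ?_, ?_⟩, fun hδ₂ hδ₂' => ?_⟩
    · exact BVS.tendstoInMeasure_maxOddsAgainstTrue_of_rpow htyp hsignal hν hc₁.ne' hc₂ hψ hφ hδ₂
        (hδ₂'.trans hδ₁.le)
    · exact BVS.not_tendstoInMeasure_truePosteriorProb_one_of_rpow hν hc₂ hcard hφ hδ₂' hdesign
    · exact hdesign.mono fun ω hω => BVS.tendsto_truePosteriorProb_zero hν hpos hcard
        (BVS.tendsto_div_natCast_zero hφ hlt) hω _
    · rintro rfl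
      exact ⟨√c₂ / (√c₂ + 1), by positivity, (div_lt_one (by positivity)).2 (lt_add_one _),
        hdesign.mono fun ω hω => BVS.limsup_truePosteriorProb_le hν hpos hcard
          (BVS.tendsto_div_natCast_const hφ) hω _⟩
    · exact BVS.tendstoInMeasure_truePosteriorProb_one_of_rpow htyp hsignal hν hc₁.ne' hc₂ hψ hφ
        hδ₂ hδ₂'
  · replace hpos := (eventually_ge_atTop 1).mono hpos
    have hnorm := hk.trans (BVS.sq_isBigO_rpow hψ)
    exact ⟨BVS.tendstoInProbAtTop_oddsAgainstTrue_empty htyp hν hne (by linarith) hnorm hpos hφ,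
      BVS.tendstoInMeasure_truePosteriorProb_zero htyp hν hne (by linarith) hnorm hpos hφ⟩
  · replace hpos := (eventually_ge_atTop 1).mono hpos
    exact hdesign.mono fun ω hω =>
      ⟨BVS.le_liminf_maxOddsAgainstTrue hν hpos hcard hη hlim hω _,
        BVS.tendsto_truePosteriorProb_zero hν hpos hcard
          (BVS.tendsto_div_natCast_of_tendsto_mul hlim) hω _⟩
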